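/- Let $t \ge 0$ and $n > 2t$ be integers, and let $\lambda$ be a partition with at most $t$ parts, with column lengths $\mu_1 \ge \dots \ge \mu_{\lambda_1}$. Notation. Let $W = W_\lambda$ be the quotient of $\bigotimes_{j=1}^{\lambda_1} \Lambda^{\mu_j}\mathbb{C}^t$ by the relations that (a) factors belonging to columns of equal length commute, and (b) for two consecutive columns, of lengths $p$ and $q$, and for $1 \le r \le q$, $$x\cdot(v_1\wedge\dots\wedge v_p)\cdot(w_1\wedge\dots\wedge w_q)\cdot y = \sum_{i_1<\dots<i_r} x\cdot(v_1\wedge\dots\wedge w_1\wedge\dots\wedge w_r\wedge\dots\wedge v_p)\cdot(v_{i_1}\wedge\dots\wedge v_{i_r}\wedge w_{r+1}\wedge\dots\wedge w_q)\cdot y,$$ where $w_1,\dots,w_r$ replace $v_{i_1},\dots,v_{i_r}$. Let $\rho(A)$ be the map induced on $W$ by a complex $t\times t$ matrix $A$. For a semistandard tableau $T$ of shape $\lambda$ with entries in $\{1,\dots,t\}$, let $e_T\in W$ be the image of the product over the columns $j$ of $e_{T(1,j)}\wedge\dots\wedge e_{T(\mu_j,j)}$. Put $\omega = (I_t\ \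 iI_t\ \ 0)\in\mathbb{C}^{t\times n}$ and $\epsilon=\binom{I_t}{0}\in\mathbb{C}^{n\times t}$. For $w\in W$ let $\phi(w)\colon O(n,\mathbb{C})\to W$ be $\phi(w)(x)=\rho(\omega x\epsilon)w$, where $O(n,\mathbb{C})=\{Q\in\mathbb{C}^{n\times n}: Q^{\mathsf T}Q=I\}$. Let $V=V_\lambda$ be the span of all right translates of the functions $\phi(w)$, and let $O(n)$ act on $V$ by right translation, $(\pi(y)f)(x)=f(xy)$. Given an inner product on $W$, put $\langle f,g\rangle=\int_{O(n)}\langle f(x),g(x)\rangle\,dx$ for $f,g\in V$, with $dx$ the normalized Haar measure. For a subgroup $H\subseteq O(n)$ let $V^H$ be the space of $H$-invariants. 1. For every inner product on $W$, all semistandard tableaux $T_1,T_2$ of shape $\lambda$ with entries in $\{1,\dots,t\}$, and every $y\in O(n)$, the integral defining $\langle\phi(e_{T_1}),\pi(y)\phi(e_{T_2})\rangle$ converges absolutely, and its value is a real number. 2. For every subgroup $H\subseteq O(n)$, the space $V^H\cap\phi(W)$ is the complex span of the vectors of $V^H$ that are real linear combinations of the vectors $\phi(e_T)$, $T$ semistandard.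 3. The semidefinite program can be restricted to real matrices, in the following sense. Let $D\subset[-1,1)$ be finite, and let $\mathcal{I}_k$ be the set of all subsets of $S^{n-1}$ of size at most $k$ in which any two distinct points have inner product in $D$. Let $R_1,\dots,R_N$ represent the distinct orbits of $O(n)$ on $\mathcal{I}_t$. For $J\in\mathcal{I}_t$ let $i(J)$ be the index of its orbit, and fix $s(J)\in O(n)$ with $s(J)R_{i(J)}=J$. Let $H_i$ be the stabilizer of $R_i$. Let $\mathcal{R}_{2t}$ be a set of representatives of the orbits of $O(n)$ on $\mathcal{I}_{2t}\setminus\{\emptyset\}$. Let $\Lambda$ be a finite set of partitions with at most $t$ parts. For $\lambda\in\Lambda$ fix an inner product on $W_\lambda$, and for each $i$ a basis $(e_{\lambda,i,j})_j$ of $V_\lambda^{H_i}$ consisting of real linear combinations of the vectors $\phi(e_T)$. For complex square matrices $F^\lambda$ indexed by the pairs $(i,j)$, put $$K_F(J_1,J_2)=\sum_{\lambda\in\Lambda}\sum_{j_1,j_2}F^\lambda_{(i(J_1),j_1),(i(J_2),j_2)}\langle\pi(s(J_1))e_{\lambda,i(J_1),j_1},\pi(s(J_2))e_{\lambda,i(J_2),j_2}\rangle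 .$$ Call $F$ feasible if every $F^\lambda$ is (Hermitian) positive semidefinite and, for every $R\in\mathcal{R}_{2t}$, the number $$A_tK_F(R)=\sum_{J,J'\in\mathcal{I}_t,\ J\cup J'=R}K_F(J,J')$$ is real and is at most $-1$ if $|R|=1$ and at most $0$ otherwise. Then for every feasible $F$ there are real positive semidefinite matrices $F'^\lambda$ such that $F'$ is feasible, has the same objective value $K_{F'}(\emptyset,\emptyset)=K_F(\emptyset,\emptyset)$, and satisfies $K_{F'}(J_1,J_2)=\operatorname{Re}K_F(J_1,J_2)$ for all $J_1,J_2\in\mathcal{I}_t$. -/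

import Mathlib

open scoped TensorProduct Matrix ComplexOrder

noncomputable section

namespace GrossKunze

/-! ### The polynomial representations of `GL_t` (Weyl's construction) -/

/-- The tautological representation `ℂ^t`. -/
abbrev Vec (t : ℕ) : Type := Fin t → ℂ

/-- The exterior power `Λ^k ℂ^t`. -/
def Wedge (t k : ℕ) : Type := ⋀[ℂ]^k (Vec t)

instance instAddCommGroupWedge (t k : ℕ) : AddCommGroup (Wedge t k) :=
  inferInstanceAs (AddCommGroup (⋀[ℂ]^k (Vec t)))

instance instModuleWedge (t k : ℕ) : Module ℂ (Wedge t k) :=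
  inferInstanceAs (Module ℂ (⋀[ℂ]^k (Vec t)))

/-- The wedge product `v 0 ∧ ⋯ ∧ v (k - 1)`. -/
def wedge {t k : ℕ} (v : Fin k → Vec t) : Wedge t k := exteriorPower.ιMulti ℂ k v

/-- The map `Λ^k A` for a matrix `A`. -/
def wedgeMap {t : ℕ} (k : ℕ) (A : Matrix (Fin t) (Fin t) ℂ) : Wedge t k →ₗ[ℂ] Wedge t k :=
  exteriorPower.map k (Matrix.toLin' A)

theorem wedgeMap_wedge {t k : ℕ} (A : Matrix (Fin t) (Fin t) ℂ) (v : Fin k → Vec t) :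
    wedgeMap k A (wedge v) = wedge fun i => A *ᵥ v i :=
  exteriorPower.map_apply_ιMulti (Matrix.toLin' A) v

theorem wedgeMap_one (t k : ℕ) : wedgeMap k (1 : Matrix (Fin t) (Fin t) ℂ) = 1 := by
  unfold wedgeMap
  rw [Matrix.toLin'_one]
  exact exteriorPower.map_id

theorem wedgeMap_mul {t : ℕ} (k : ℕ) (A B : Matrix (Fin t) (Fin t) ℂ) :
    wedgeMap k (A * B) = wedgeMap k A * wedgeMap k B := by
  unfold wedgeMap
  rw [Matrix.toLin'_mul]
  exact exteriorPower.map_comp (Matrix.toLin' B) (Matrix.toLin' A)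

/-- The tensor product over the columns of the Young diagram (from left to right) of the exterior
powers `Λ^(μ_j) ℂ^t`, where `μ_j` is the length of column `j`. -/
abbrev ColTensor (lam : YoungDiagram) (t : ℕ) : Type :=
  ⨂[ℂ] j : Fin (lam.rowLen 0), Wedge t (lam.colLen j)

/-- For a filling `v` of the boxes of the diagram by vectors (`v i j` is the vector in row `i` and
column `j`, counted from `0`; the values outside the diagram are irrelevant), the product over
the columns `j` of the wedges `v 0 j ∧ ⋯ ∧ v (μ_j - 1) j`. -/
def colElt (lam : YoungDiagram) (t : ℕ) (v : ℕ → ℕ → Vec t) : ColTensor lam t :=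
  PiTensorProduct.tprod ℂ fun j : Fin (lam.rowLen 0) =>
    wedge fun i : Fin (lam.colLen j) => v i j

/-- Exchange of the columns `j` and `k` of a filling. -/
def swapCols {t : ℕ} (v : ℕ → ℕ → Vec t) (j k : ℕ) : ℕ → ℕ → Vec t :=
  fun i c => v i (Equiv.swap j k c)

/-- The filling obtained from `v` by exchanging the first `r` vectors of column `j + 1` with the
vectors of column `j` at the rows `f 0 < f 1 < ⋯ < f (r - 1)`, in this order. -/
def exchange {t r : ℕ} (v : ℕ → ℕ → Vec t) (j : ℕ) (f : Fin r → ℕ) : ℕ → ℕ → Vec t :=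
  fun i c =>
    if c = j then Function.extend f (fun m => v m (j + 1)) (fun i => v i j) i
    else if c = j + 1 then (if h : i < r then v (f ⟨i, h⟩) j else v i (j + 1))
    else v i c

open Classical in
/-- The relations defining `W` as a quotient of `⨂_j Λ^(μ_j) ℂ^t`. The relations `symm` (columns
of the same length commute) define `A^a ℂ^t = Sym^(a_t)(Λ^t ℂ^t) ⊗ ⋯ ⊗ Sym^(a_1)(ℂ^t)`, where
`a_k` is the number of columns of length `k`; the relations `exch` are the exchange relations for
two consecutive columns of lengths `p = lam.colLen j` and `q = lam.colLen (j + 1)`. -/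
inductive IsRelation (lam : YoungDiagram) (t : ℕ) : ColTensor lam t → Prop
  | symm (v : ℕ → ℕ → Vec t) (j k : ℕ) (hj : j < lam.rowLen 0) (hk : k < lam.rowLen 0)
      (h : lam.colLen j = lam.colLen k) :
      IsRelation lam t (colElt lam t v - colElt lam t (swapCols v j k))
  | exch (v : ℕ → ℕ → Vec t) (j r : ℕ) (hr : 1 ≤ r) (hrq : r ≤ lam.colLen (j + 1)) :
      IsRelation lam t (colElt lam t v -
        ∑ f : {f : Fin r → Fin (lam.colLen j) // StrictMono f},
          colElt lam t (exchange v j fun m => (f.1 m : ℕ)))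

/-- The subspace spanned by the relations. -/
def relations (lam : YoungDiagram) (t : ℕ) : Submodule ℂ (ColTensor lam t) :=
  Submodule.span ℂ {x | IsRelation lam t x}

/-- The space `W = W_lam` of the irreducible polynomial representation of `GL_t` labelled by the
partition `lam`. -/
def W (lam : YoungDiagram) (t : ℕ) : Type := ColTensor lam t ⧸ relations lam t

instance instAddCommGroupW (lam : YoungDiagram) (t : ℕ) : AddCommGroup (W lam t) :=
  inferInstanceAs (AddCommGroup (ColTensor lam t ⧸ relations lam t))

instance instModuleW (lam : YoungDiagram) (t : ℕ) : Module ℂ (W lam t) :=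
  inferInstanceAs (Module ℂ (ColTensor lam t ⧸ relations lam t))

/-- The quotient map onto `W`. -/
def toW (lam : YoungDiagram) (t : ℕ) : ColTensor lam t →ₗ[ℂ] W lam t := (relations lam t).mkQ

/-- The action of a `t × t` matrix on the product of exterior powers. -/
def rhoTensor (lam : YoungDiagram) (t : ℕ) (A : Matrix (Fin t) (Fin t) ℂ) :
    ColTensor lam t →ₗ[ℂ] ColTensor lam t :=
  PiTensorProduct.map fun j : Fin (lam.rowLen 0) => wedgeMap (lam.colLen j) A

theorem rhoTensor_colElt (lam : YoungDiagram) (t : ℕ) (A : Matrix (Fin t) (Fin t) ℂ)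
    (v : ℕ → ℕ → Vec t) :
    rhoTensor lam t A (colElt lam t v) = colElt lam t fun i j => A *ᵥ v i j := by
  simp only [rhoTensor, colElt, PiTensorProduct.map_tprod, wedgeMap_wedge]

theorem exchange_map {t r : ℕ} (A : Matrix (Fin t) (Fin t) ℂ) (v : ℕ → ℕ → Vec t) (j : ℕ)
    (f : Fin r → ℕ) :
    (fun i c => A *ᵥ exchange v j f i c) = exchange (fun i c => A *ᵥ v i c) j f := by
  classical
  funext i c
  simp only [exchange, Function.extend]
  split_ifs <;> rfl

theorem relations_le_comap (lam : YoungDiagram) (t : ℕ) (A : Matrix (Fin t) (Fin t) ℂ) :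
    relations lam t ≤ (relations lam t).comap (rhoTensor lam t A) := by
  refine Submodule.span_le.2 ?_
  rintro x (⟨v, j, k, hj, hk, h⟩ | ⟨v, j, r, hr, hrq⟩)
  · simp only [Submodule.comap_coe, Set.mem_preimage, SetLike.mem_coe, map_sub, rhoTensor_colElt]
    exact Submodule.subset_span (IsRelation.symm (fun i c => A *ᵥ v i c) j k hj hk h)
  · simp only [Submodule.comap_coe, Set.mem_preimage, SetLike.mem_coe, map_sub, map_sum,
      rhoTensor_colElt, exchange_map]
    exact Submodule.subset_span (IsRelation.exch (fun i c => A *ᵥ v i c) j r hr hrq)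

/-- The action of a `t × t` matrix on `W`. -/
def rhoMap (lam : YoungDiagram) (t : ℕ) (A : Matrix (Fin t) (Fin t) ℂ) :
    W lam t →ₗ[ℂ] W lam t :=
  (relations lam t).mapQ (relations lam t) (rhoTensor lam t A) (relations_le_comap lam t A)

theorem rhoMap_toW (lam : YoungDiagram) (t : ℕ) (A : Matrix (Fin t) (Fin t) ℂ)
    (x : ColTensor lam t) : rhoMap lam t A (toW lam t x) = toW lam t (rhoTensor lam t A x) :=
  rfl

theorem toW_surjective (lam : YoungDiagram) (t : ℕ) : Function.Surjective (toW lam t) :=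
  Submodule.mkQ_surjective _

/-- The polynomial representation `ρ`, on all `t × t` matrices (being polynomial, it extends from
`GL_t` to all matrices). -/
def rho (lam : YoungDiagram) (t : ℕ) : Matrix (Fin t) (Fin t) ℂ →* Module.End ℂ (W lam t) where
  toFun A := rhoMap lam t A
  map_one' := by
    refine LinearMap.ext fun w => ?_
    obtain ⟨x, rfl⟩ := toW_surjective lam t w
    simp only [rhoMap_toW, rhoTensor, wedgeMap_one, PiTensorProduct.map_one, Module.End.one_apply]
  map_mul' A B := by
    refine LinearMap.ext fun w => ?_
    obtain ⟨x, rfl⟩ := toW_surjective lam t w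
    simp only [rhoMap_toW, rhoTensor, wedgeMap_mul, PiTensorProduct.map_mul, Module.End.mul_apply]

/-- The semistandard tableaux of shape `lam` with entries in `{0, …, t - 1}`. -/
abbrev Tableau (lam : YoungDiagram) (t : ℕ) : Type :=
  {T : SemistandardYoungTableau lam // ∀ i j, (i, j) ∈ lam → T i j < t}

/-- The vector `e_T ∈ W`: the image of the product over the columns of `T` of the wedges of the
standard basis vectors indexed by the entries in the column. -/
def tabVec {lam : YoungDiagram} {t : ℕ} (T : Tableau lam t) : W lam t :=
  toW lam t (colElt lam t fun i j k => if (k : ℕ) = T.1 i j then 1 else 0)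

/-! ### The Gross–Kunze construction -/

/-- The compact group `O(n)`. -/
abbrev O (n : ℕ) : Type := Matrix.orthogonalGroup (Fin n) ℝ

/-- The complex orthogonal group `O(n, ℂ)` of complex matrices with `Q Qᵀ = 1`. -/
abbrev OC (n : ℕ) : Type := Matrix.orthogonalGroup (Fin n) ℂ

/-- The inclusion `O(n) ⊆ O(n, ℂ)`. -/
def toOC (n : ℕ) : O n →* OC n where
  toFun x := ⟨x.1.map Complex.ofRealHom, by
    have h := (Matrix.mem_orthogonalGroup_iff _ _).1 x.2
    rw [Matrix.mem_orthogonalGroup_iff, ← Matrix.transpose_map, ← Matrix.map_mul, h]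
    exact Matrix.map_one _ (map_zero _) (map_one _)⟩
  map_one' := Subtype.ext (Matrix.map_one _ (map_zero _) (map_one _))
  map_mul' x y := Subtype.ext (Matrix.map_mul (f := Complex.ofRealHom))

/-- The `t × n` matrix `ω = (I_t, i I_t, 0)` (for `2 t ≤ n`). -/
def omega (t n : ℕ) : Matrix (Fin t) (Fin n) ℂ :=
  Matrix.of fun a b => if (b : ℕ) = a then 1 else if (b : ℕ) = t + a then Complex.I else 0

/-- The `n × t` matrix `ε` whose upper block is `I_t` and whose lower block is `0`. -/
def eps (n t : ℕ) : Matrix (Fin n) (Fin t) ℂ :=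
  Matrix.of fun a b => if (a : ℕ) = b then 1 else 0

/-- The function `φ(w) : O(n, ℂ) → W`, `φ(w)(x) = ρ(ω x ε) w`. -/
def phiFun (lam : YoungDiagram) (t n : ℕ) : W lam t →ₗ[ℂ] (OC n → W lam t) where
  toFun w x := rho lam t (omega t n * x.1 * eps n t) w
  map_add' _ _ := by funext x; simp
  map_smul' _ _ := by funext x; simp

/-- Right translation of functions on `O(n, ℂ)`: `(ξ f)(x) = f(x ξ)`. -/
def translate (lam : YoungDiagram) (t n : ℕ) :
    Representation ℂ (OC n) (OC n → W lam t) where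
  toFun ξ := LinearMap.funLeft ℂ (W lam t) fun x => x * ξ
  map_one' := by ext f x; simp
  map_mul' ξ ζ := by ext f x; simp [mul_assoc]

/-- The space `V` spanned by the right translates of the functions `φ(w)`. -/
def V (lam : YoungDiagram) (t n : ℕ) : Submodule ℂ (OC n → W lam t) :=
  Submodule.span ℂ
    {g | ∃ (ξ : OC n) (w : W lam t), g = translate lam t n ξ (phiFun lam t n w)}

theorem translate_mem (lam : YoungDiagram) (t n : ℕ) (ξ : OC n) (f : OC n → W lam t)
    (hf : f ∈ V lam t n) : translate lam t n ξ f ∈ V lam t n := by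
  induction hf using Submodule.span_induction with
  | mem f h =>
    obtain ⟨ζ, w, rfl⟩ := h
    refine Submodule.subset_span ⟨ξ * ζ, w, ?_⟩
    rw [map_mul, Module.End.mul_apply]
  | zero => rw [map_zero]; exact Submodule.zero_mem _
  | add f g _ _ hf hg => rw [map_add]; exact Submodule.add_mem _ hf hg
  | smul a f _ hf => rw [map_smul]; exact Submodule.smul_mem _ a hf

/-- The representation of `O(n, ℂ)` on `V` by right translation. -/
def piC (lam : YoungDiagram) (t n : ℕ) : Representation ℂ (OC n) (V lam t n) where
  toFun ξ := (translate lam t n ξ).restrict (translate_mem lam t n ξ)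
  map_one' := by ext f; simp
  map_mul' ξ ζ := by ext f; simp

/-- The representation `π` of `O(n)` on `V`. -/
def piR (lam : YoungDiagram) (t n : ℕ) : Representation ℂ (O n) (V lam t n) :=
  (piC lam t n).comp (toOC n)

/-- The linear map `φ : W → V`. -/
def phi (lam : YoungDiagram) (t n : ℕ) : W lam t →ₗ[ℂ] V lam t n :=
  (phiFun lam t n).codRestrict (V lam t n) fun w =>
    Submodule.subset_span ⟨1, w, by rw [map_one]; rfl⟩

/-! ### The inner product on `V` -/

instance instMeasurableSpaceO (n : ℕ) : MeasurableSpace (O n) := borel _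

instance instBorelSpaceO (n : ℕ) : BorelSpace (O n) := ⟨rfl⟩

instance instCompactSpaceO (n : ℕ) : CompactSpace (O n) := by
  refine isCompact_iff_compactSpace.1 ?_
  have hK : IsCompact (Set.univ.pi fun _ : Fin n => Set.univ.pi fun _ : Fin n =>
      Set.Icc (-1 : ℝ) 1) :=
    isCompact_univ_pi fun _ => isCompact_univ_pi fun _ => isCompact_Icc
  have hcl : IsClosed {A : Matrix (Fin n) (Fin n) ℝ | A * Aᵀ = 1} :=
    isClosed_eq (by fun_prop) continuous_const
  have hset : ((Matrix.orthogonalGroup (Fin n) ℝ : Set (Matrix (Fin n) (Fin n) ℝ))) =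
      {A : Matrix (Fin n) (Fin n) ℝ | A * Aᵀ = 1} := by
    ext A
    exact Matrix.mem_orthogonalGroup_iff _ _
  rw [hset]
  refine hK.of_isClosed_subset hcl ?_
  intro (A : Matrix (Fin n) (Fin n) ℝ) hA i _ j _
  have h1 : ∑ k, A i k * A i k = 1 := by
    have := congrFun (congrFun (show A * Aᵀ = 1 from hA) i) i
    simpa [Matrix.mul_apply] using this
  have h2 : A i j * A i j ≤ ∑ k, A i k * A i k :=
    Finset.single_le_sum (f := fun k => A i k * A i k) (fun k _ => mul_self_nonneg _)
      (Finset.mem_univ j)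
  exact abs_le.1 ((sq_le_one_iff_abs_le_one _).1 (by nlinarith))

/-- The normalized Haar measure on `O(n)`. -/
def haarO (n : ℕ) : MeasureTheory.Measure (O n) := MeasureTheory.Measure.haarMeasure ⊤

/-- The function `x ↦ ⟨f x, g x⟩` on `O(n)`, for a given inner product on `W`. -/
def integrand {lam : YoungDiagram} {t n : ℕ} (c : InnerProductSpace.Core ℂ (W lam t))
    (f g : V lam t n) (x : O n) : ℂ :=
  c.inner (f.1 (toOC n x)) (g.1 (toOC n x))

/-- The inner product `⟨f, g⟩ = ∫_{O(n)} ⟨f x, g x⟩ dx` on `V` (conjugate linear in the first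
variable), for a given inner product on `W`. -/
def innerV {lam : YoungDiagram} {t n : ℕ} (c : InnerProductSpace.Core ℂ (W lam t))
    (f g : V lam t n) : ℂ :=
  ∫ x, integrand c f g x ∂(haarO n)

/-- The subspace of `V` of the invariants of a subgroup `H` of `O(n)`. -/
def invariants (lam : YoungDiagram) (t : ℕ) {n : ℕ} (H : Subgroup (O n)) :
    Submodule ℂ (V lam t n) where
  carrier := {v | ∀ h ∈ H, piR lam t n h v = v}
  add_mem' ha hb h hh := by rw [map_add, ha h hh, hb h hh]
  zero_mem' h _ := map_zero _
  smul_mem' a v hv h hh := by rw [map_smul, hv h hh]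

/-- The real linear combinations of the vectors `φ(e_T)`, `T` semistandard. -/
def realSpan (lam : YoungDiagram) (t n : ℕ) : Submodule ℝ (V lam t n) :=
  Submodule.span ℝ (Set.range fun T : Tableau lam t => phi lam t n (tabVec T))

/-! ### The semidefinite program -/

/-- The image of a finite set of points under an orthogonal transformation. -/
def act {n : ℕ} (g : O n) (J : Finset (Fin n → ℝ)) : Finset (Fin n → ℝ) :=
  by classical exact J.image fun x => g.1 *ᵥ x

theorem act_act {n : ℕ} (g h : O n) (J : Finset (Fin n → ℝ)) : act g (act h J) = act (g * h) J := by
  classical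
  simp only [act, Finset.image_image]
  congr 1
  funext x
  simp

theorem act_one {n : ℕ} (J : Finset (Fin n → ℝ)) : act 1 J = J := by
  classical
  simp [act]

/-- The stabilizer of a finite set of points in `O(n)`. -/
def stab {n : ℕ} (J : Finset (Fin n → ℝ)) : Subgroup (O n) where
  carrier := {g | act g J = J}
  mul_mem' {a b} ha hb := by
    change act (a * b) J = J
    rw [← act_act, hb, ha]
  one_mem' := act_one J
  inv_mem' {a} ha := by
    change act a⁻¹ J = J
    conv_lhs => rw [← show act a J = J from ha]
    rw [act_act, inv_mul_cancel, act_one]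

/-- `I_k`: the sets of at most `k` points of the unit sphere such that the inner product of any two
distinct points lies in `D`. -/
def indep (n k : ℕ) (D : Finset ℝ) : Set (Finset (Fin n → ℝ)) :=
  {J | J.card ≤ k ∧ (∀ x ∈ J, x ⬝ᵥ x = 1) ∧ ∀ x ∈ J, ∀ y ∈ J, x ≠ y → x ⬝ᵥ y ∈ D}

/-- A choice of representatives of the `N` orbits of `O(n)` on `I_t`, and of transformations that
carry the representatives to the elements of their orbits. -/
structure OrbitChoice (n t : ℕ) (D : Finset ℝ) (N : ℕ) where
  /-- the orbit representatives -/
  R : Fin N → Finset (Fin n → ℝ)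
  /-- the index of the orbit of `J` -/
  idx : Finset (Fin n → ℝ) → Fin N
  /-- the transformation that carries the representative of the orbit of `J` to `J` -/
  s : Finset (Fin n → ℝ) → O n
  R_mem : ∀ i, R i ∈ indep n t D
  act_s : ∀ J ∈ indep n t D, act (s J) (R (idx J)) = J
  R_distinct : ∀ i j g, act g (R i) = R j → i = j

/-- `S` is a set of representatives of the orbits of `O(n)` on `I_(2t) \ {∅}`. -/
def IsConstraintSet (n t : ℕ) (D : Finset ℝ) (S : Set (Finset (Fin n → ℝ))) : Prop :=
  S ⊆ indep n (2 * t) D \ {∅} ∧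
    ∀ J ∈ indep n (2 * t) D \ {∅}, ∃! Q, Q ∈ S ∧ ∃ g, act g Q = J

/-- The kernel
`K(J₁, J₂) = ∑_lam ∑_{j₁, j₂} F^lam_{(i(J₁), j₁), (i(J₂), j₂)} ⟨π(s(J₁)) e_{lam, i(J₁), j₁}, π(s(J₂)) e_{lam, i(J₂), j₂}⟩`,
where `e_{lam, i, j}` is a basis of the invariants of the stabilizer of `R_i` in `V_lam`. -/
def kernel {n t N : ℕ} {D : Finset ℝ} (orb : OrbitChoice n t D N) {Lam : Finset YoungDiagram}
    (c : ∀ l : Lam, InnerProductSpace.Core ℂ (W l.1 t)) {d : Lam → Fin N → ℕ}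
    (e : ∀ l i, Module.Basis (Fin (d l i)) ℂ (invariants (n := n) l.1 t (stab (orb.R i))))
    (F : ∀ l : Lam, Matrix (Σ i, Fin (d l i)) (Σ i, Fin (d l i)) ℂ)
    (J₁ J₂ : Finset (Fin n → ℝ)) : ℂ :=
  ∑ l, ∑ j₁ : Fin (d l (orb.idx J₁)), ∑ j₂ : Fin (d l (orb.idx J₂)),
    F l ⟨orb.idx J₁, j₁⟩ ⟨orb.idx J₂, j₂⟩ *
      innerV (c l) (piR l.1 t n (orb.s J₁) (e l (orb.idx J₁) j₁))
        (piR l.1 t n (orb.s J₂) (e l (orb.idx J₂) j₂))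

open Classical in
/-- `A_t K (S) = ∑ K(J, J')`, the sum over the `J, J'` of size at most `t` with `J ∪ J' = S`. -/
def opA {n : ℕ} (t : ℕ) (K : Finset (Fin n → ℝ) → Finset (Fin n → ℝ) → ℂ)
    (S : Finset (Fin n → ℝ)) : ℂ :=
  ∑ p ∈ (S.powerset ×ˢ S.powerset).filter
    (fun p => p.1.card ≤ t ∧ p.2.card ≤ t ∧ p.1 ∪ p.2 = S), K p.1 p.2

/-- Feasibility in the semidefinite program: the matrices `F^lam` are positive semidefinite and the
kernel satisfies `A_t K(R) ≤ -1_{I_{=1}}(R)` for all representatives `R ∈ S`. (The order of `ℂ`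
is used: the inequality says that `A_t K(R)` is real and at most the right hand side.) -/
structure IsFeasible {n t N : ℕ} {D : Finset ℝ} (orb : OrbitChoice n t D N)
    (S : Set (Finset (Fin n → ℝ))) {Lam : Finset YoungDiagram}
    (c : ∀ l : Lam, InnerProductSpace.Core ℂ (W l.1 t)) {d : Lam → Fin N → ℕ}
    (e : ∀ l i, Module.Basis (Fin (d l i)) ℂ (invariants (n := n) l.1 t (stab (orb.R i))))
    (F : ∀ l : Lam, Matrix (Σ i, Fin (d l i)) (Σ i, Fin (d l i)) ℂ) : Prop where
  posSemidef : ∀ l, (F l).PosSemidef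
  constraint : ∀ Q ∈ S, opA t (kernel orb c e F) Q ≤ if Q.card = 1 then -1 else 0

end GrossKunze

end

noncomputable section

namespace GrossKunze

/-! ### The exchange identity for determinants -/

/-! Everything rests on two symmetries of `ω`. For unitary `u` there is `k ∈ O(n)` with `ω k = u ω`,
and there is `d ∈ O(n)` with `ω d = conj ω`. Left invariance of Haar measure turns both into
symmetries of the integrals.

Fix `T₁, T₂, y₁, y₂`. The integrals `B(f, g)` of the conjugate of `f (π(y₁)φ(e_T₁)(x))` times `g
(π(y₂)φ(e_T₂)(x))` form a sesquilinear form on the dual of `W`, invariant under `U(t)`. Let `L` be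
`highestForm`, the product over the columns of the top minors. The functional `B(L, ·)` is
evaluation at some `q ∈ W`, and invariance under a single diagonal unitary matrix forces `q = κ
e_high` with `κ = B(L, L)`. The constant `κ` is real by the symmetry `d`, since `L(ρ(A) e_T)` is a
polynomial in `A` with real coefficients. Hence `B(L∘ρ(u), L∘ρ(v)) = κ L(ρ(v uᴴ) e_high)`, a product
of leading principal minors of `v uᴴ`, which is conjugated when `u` and `v` are interchanged. The
forms `L∘ρ(u)` span the dual, so `B` is Hermitian (`conj_coeffForm`). For an arbitrary inner product
on `W`, the number in question is a pairing of two Hermitian matrices, the Gram matrix of a basis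
and the matrix of `B` in the coordinate forms. It is therefore real (`im_innerV_tabVec`).

The facts about `W` behind this are: `L` respects the exchange relations (`det_exchange`), the `e_T`
span `W` by straightening (`span_tabVec`), and the functions `L(ρ(A) e_T)` are linearly independent
by their leading monomials, even on unitary `A` (`tabMinor_independent`,
`sum_tabMinor_eq_zero_of_unitary`).

For the invariants, conjugating the coefficients of `w` in the `e_T` corresponds, through `d`, to
evaluating `φ(w)` at `d` times the conjugate point. This is compatible with right translation by
real matrices, so real and imaginary parts of invariants are invariant. For the program, the kernel
depends linearly on `F` with real coefficients, so the entrywise real part of `F` yields the real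
part of the kernel. -/

theorem extend_update {ι κ M : Type*} [DecidableEq ι] [DecidableEq κ] {f : ι → κ}
    (hf : Function.Injective f) (w : ι → M) (v : κ → M) (i : ι) (x : M) :
    Function.extend f (Function.update w i x) v =
      Function.update (Function.extend f w v) (f i) x := by
  funext k
  by_cases hk : ∃ j, f j = k
  · obtain ⟨j, rfl⟩ := hk
    rw [hf.extend_apply]
    rcases eq_or_ne j i with rfl | h
    · simp
    · rw [Function.update_of_ne h, Function.update_of_ne (hf.ne h), hf.extend_apply]
  · rw [Function.extend_apply' _ _ _ hk, Function.update_of_ne, Function.extend_apply' _ _ _ hk]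
    rintro rfl
    exact hk ⟨i, rfl⟩

/-- Fix the arguments of an alternating map outside the range of an injection. -/
def alternatingExtend {ι κ M : Type*} [AddCommGroup M] [Module ℂ M]
    (g : M [⋀^κ]→ₗ[ℂ] ℂ) {f : ι → κ} (hf : Function.Injective f) (v : κ → M) :
    M [⋀^ι]→ₗ[ℂ] ℂ where
  toFun w := g (Function.extend f w v)
  map_update_add' w i x y := by
    classical
    simp only [extend_update hf, AlternatingMap.map_update_add]
  map_update_smul' w i a x := by
    classical
    simp only [extend_update hf, AlternatingMap.map_update_smul]
  map_eq_zero_of_eq' w i j h hij := by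
    refine g.map_eq_zero_of_eq _ (i := f i) (j := f j) ?_ (hf.ne hij)
    rw [hf.extend_apply, hf.extend_apply, h]

theorem alternatingExtend_apply {ι κ M : Type*} [AddCommGroup M] [Module ℂ M]
    (g : M [⋀^κ]→ₗ[ℂ] ℂ) {f : ι → κ} (hf : Function.Injective f) (v : κ → M) (w : ι → M) :
    alternatingExtend g hf v w = g (Function.extend f w v) := rfl

theorem extend_comp_self {ι κ M : Type*} {f : ι → κ} (hf : Function.Injective f) (v : κ → M) :
    Function.extend f (v ∘ f) v = v := by
  funext k
  by_cases hk : ∃ j, f j = k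
  · obtain ⟨j, rfl⟩ := hk
    rw [hf.extend_apply]; rfl
  · rw [Function.extend_apply' _ _ _ hk]

theorem alternatingMap_sum_apply {α ι M : Type*} [AddCommGroup M] [Module ℂ M] (s : Finset α)
    (A : α → M [⋀^ι]→ₗ[ℂ] ℂ) (v : ι → M) : (∑ a ∈ s, A a) v = ∑ a ∈ s, A a v := by
  classical
  induction s using Finset.induction_on with
  | empty => simp
  | insert a s h ih => rw [Finset.sum_insert h, Finset.sum_insert h, AlternatingMap.add_apply, ih]

open Classical in
-- Both sides are alternating in `w`, so it suffices to take for `w` distinct vectors `b ∘ g` of the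
-- basis. Then the only surviving term is the increasing rearrangement of `g`, which puts each basis
-- vector back in its own place.
theorem exchange_of_basis {p r : ℕ} {M : Type*} [AddCommGroup M] [Module ℂ M]
    (b : Module.Basis (Fin p) ℂ M) (D : M [⋀^Fin p]→ₗ[ℂ] ℂ) (H : M [⋀^Fin r]→ₗ[ℂ] ℂ)
    (w : Fin r → M) :
    D b * H w = ∑ f : {f : Fin r → Fin p // StrictMono f},
      D (Function.extend f.1 w b) * H (b ∘ f.1) := by
  suffices h : D b • H = ∑ f : {f : Fin r → Fin p // StrictMono f},
      H (b ∘ f.1) • alternatingExtend D f.2.injective b by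
    have := congrArg (fun A : M [⋀^Fin r]→ₗ[ℂ] ℂ => A w) h
    simpa [alternatingMap_sum_apply, alternatingExtend_apply, mul_comm] using this
  refine Module.Basis.ext_alternating b fun g hg => ?_
  change (D b • H) (b ∘ g) = (∑ f : {f : Fin r → Fin p // StrictMono f},
      H (b ∘ f.1) • alternatingExtend D f.2.injective b) (b ∘ g)
  set σ := Tuple.sort g
  have hf0 : StrictMono (g ∘ σ) :=
    (Tuple.monotone_sort g).strictMono_of_injective (hg.comp σ.injective)
  have hbg : ∀ A : M [⋀^Fin r]→ₗ[ℂ] ℂ,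
      A (b ∘ g) = Equiv.Perm.sign σ⁻¹ • A (b ∘ (g ∘ σ)) := by
    intro A
    rw [← AlternatingMap.map_perm]
    congr 1
    funext m
    simp
  rw [alternatingMap_sum_apply, Finset.sum_eq_single ⟨g ∘ σ, hf0⟩]
  · simp only [AlternatingMap.smul_apply, smul_eq_mul]
    rw [hbg H, hbg (alternatingExtend _ _ _), alternatingExtend_apply,
      extend_comp_self hf0.injective]
    rw [mul_smul_comm, mul_smul_comm, mul_comm]
  · intro f _ hf
    rw [AlternatingMap.smul_apply, alternatingExtend_apply]
    -- If `g m` is not among the replaced positions, `b (g m)` stands both at position `f m` and at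
    -- its own position `g m`, so `D` vanishes. Otherwise `f` and `g` have the same range, and `f`
    -- is the sorted `g`.
    suffices h : ∃ m, g m ∉ Set.range f.1 by
      obtain ⟨m, hm⟩ := h
      rw [D.map_eq_zero_of_eq _ (i := f.1 m) (j := g m), smul_zero]
      · rw [f.2.injective.extend_apply, Function.extend_apply' _ _ _ (fun h => hm h)]
        rfl
      · exact fun h => hm ⟨m, h⟩
    by_contra! h
    refine hf (Subtype.ext ((f.2.range_inj hf0).1 ?_))
    rw [σ.surjective.range_comp]
    symm
    have h1 : Finset.univ.image g ⊆ Finset.univ.image f.1 := by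
      intro x hx
      obtain ⟨m, -, rfl⟩ := Finset.mem_image.1 hx
      obtain ⟨k, hk⟩ := h m
      exact Finset.mem_image.2 ⟨k, Finset.mem_univ _, hk⟩
    have h2 := Finset.eq_of_subset_of_card_le h1 (by
      rw [Finset.card_image_of_injective _ hg, Finset.card_image_of_injective _ f.2.injective])
    simpa using congrArg (fun s : Finset (Fin p) => (s : Set (Fin p))) h2
  · exact fun h => absurd (Finset.mem_univ _) h

theorem continuous_alternatingMap_pi {r p : ℕ} (A : (Fin p → ℂ) [⋀^Fin r]→ₗ[ℂ] ℂ) :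
    Continuous A := by
  have h : ∀ v : Fin r → Fin p → ℂ,
      A v = ∑ c : Fin r → Fin p, (∏ i, v i (c i)) * A fun i => Pi.single (c i) 1 := by
    intro v
    have hv : v = fun i => ∑ j, v i j • (Pi.single j 1 : Fin p → ℂ) :=
      funext fun i => pi_eq_sum_univ' (v i)
    conv_lhs => rw [hv]
    refine (A.toMultilinearMap.map_sum _).trans (Finset.sum_congr rfl fun c _ => ?_)
    exact A.toMultilinearMap.map_smul_univ _ _
  refine (continuous_finsetSum _ fun c _ => ?_).congr fun v => (h v).symm
  fun_prop

theorem finite_det_add_scalar_eq_zero {p : ℕ} (v : Matrix (Fin p) (Fin p) ℂ) :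
    {z : ℂ | (v + Matrix.scalar (Fin p) z).det = 0}.Finite := by
  have h : {z : ℂ | (v + Matrix.scalar (Fin p) z).det = 0} ⊆ {z | z ∈ (-v).charpoly.roots} := by
    intro z hz
    rw [Set.mem_ofPred_eq, Polynomial.mem_roots (Matrix.charpoly_monic _).ne_zero,
      Polynomial.IsRoot, Matrix.eval_charpoly]
    simpa [add_comm] using hz
  exact (Multiset.finite_toSet _).subset h

open Classical in
/-- The exchange identity of Sylvester: on `ℂ^p`, the product of a determinant and an alternating
form in `r` further vectors is unchanged when these vectors are exchanged with `r` columns of the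
determinant in all possible ways. -/
theorem det_exchange {p r : ℕ} (v : Fin p → Fin p → ℂ) (w : Fin r → Fin p → ℂ)
    (H : (Fin p → ℂ) [⋀^Fin r]→ₗ[ℂ] ℂ) :
    Matrix.detRowAlternating v * H w = ∑ f : {f : Fin r → Fin p // StrictMono f},
      Matrix.detRowAlternating (Function.extend f.1 w v) * H (v ∘ f.1) := by
  -- The rows of `v + z` form a basis for all but finitely many `z`; both sides are continuous in
  -- `z`, so the case of a basis extends to `z = 0`.
  let V : ℂ → Fin p → Fin p → ℂ := fun z => Matrix.of v + Matrix.scalar (Fin p) z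
  have hV0 : V 0 = v := by simp [V]; rfl
  have hVc : Continuous V := by
    refine continuous_pi fun i => continuous_pi fun j => ?_
    by_cases h : i = j
    · subst h; simp [V]; fun_prop
    · simp [V, h]; fun_prop
  have hdense : Dense {z : ℂ | (Matrix.of v + Matrix.scalar (Fin p) z).det ≠ 0} :=
    (finite_det_add_scalar_eq_zero (Matrix.of v)).countable.dense_compl ℝ
  suffices h : (fun z => Matrix.detRowAlternating (V z) * H w) = fun z =>
      ∑ f : {f : Fin r → Fin p // StrictMono f},
        Matrix.detRowAlternating (Function.extend f.1 w (V z)) * H (V z ∘ f.1) by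
    have := congrFun h 0
    simpa only [hV0] using this
  refine Continuous.ext_on hdense ?_ ?_ ?_
  · exact ((continuous_alternatingMap_pi _).comp hVc).mul continuous_const
  · refine continuous_finsetSum _ fun f _ => ?_
    refine ((continuous_alternatingMap_pi _).comp ?_).mul
      ((continuous_alternatingMap_pi H).comp ?_)
    · refine continuous_pi fun k => ?_
      by_cases hk : ∃ j, f.1 j = k
      · obtain ⟨j, rfl⟩ := hk
        simp only [f.2.injective.extend_apply]
        exact continuous_const
      · simp only [Function.extend_apply' _ _ _ hk]
        exact (continuous_apply k).comp hVc
    · exact continuous_pi fun k => (continuous_apply (f.1 k)).comp hVc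
  · intro z hz
    have hli : LinearIndependent ℂ (V z) :=
      Matrix.linearIndependent_rows_of_det_ne_zero (A := V z) hz
    let b := Module.Basis.mk hli (hli.span_eq_top_of_card_eq_finrank' (by simp)).ge
    have hb : (b : Fin p → Fin p → ℂ) = V z := Module.Basis.coe_mk _ _
    have := exchange_of_basis b Matrix.detRowAlternating H w
    rwa [hb] at this

/-! ### The highest weight functional on `W` -/

/-- The minor of the first `p` coordinates of `p` vectors. -/
def topMinor {p t : ℕ} (h : p ≤ t) : Vec t [⋀^Fin p]→ₗ[ℂ] ℂ :=
  Matrix.detRowAlternating.compLinearMap (LinearMap.funLeft ℂ ℂ (Fin.castLE h))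

theorem topMinor_apply {p t : ℕ} (h : p ≤ t) (v : Fin p → Vec t) :
    topMinor h v = (Matrix.of fun i i' : Fin p => v i (Fin.castLE h i')).det := rfl

theorem topMinor_congr {p p' t : ℕ} (h : p ≤ t) (h' : p' ≤ t) (e : p = p') (v : ℕ → Vec t) :
    topMinor h (fun i : Fin p => v i) = topMinor h' (fun i : Fin p' => v i) := by
  subst e; rfl

/-- The linear form on `Λ^p ℂ^t` given by `topMinor`. -/
def wedgeForm {p t : ℕ} (h : p ≤ t) : Wedge t p →ₗ[ℂ] ℂ :=
  exteriorPower.alternatingMapLinearEquiv (topMinor h)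

theorem wedgeForm_wedge {p t : ℕ} (h : p ≤ t) (v : Fin p → Vec t) :
    wedgeForm h (wedge v) = topMinor h v :=
  exteriorPower.alternatingMapLinearEquiv_apply_ιMulti _ _

theorem colLen_le {lam : YoungDiagram} {t : ℕ} (h : lam.colLen 0 ≤ t) (j : ℕ) :
    lam.colLen j ≤ t :=
  (lam.colLen_anti 0 j (Nat.zero_le j)).trans h

/-- The product over the columns of the linear forms `wedgeForm`. -/
def colForm {lam : YoungDiagram} {t : ℕ} (h : lam.colLen 0 ≤ t) : ColTensor lam t →ₗ[ℂ] ℂ :=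
  PiTensorProduct.lift ((MultilinearMap.mkPiAlgebra ℂ (Fin (lam.rowLen 0)) ℂ).compLinearMap
    fun j => wedgeForm (colLen_le h j))

theorem colForm_colElt {lam : YoungDiagram} {t : ℕ} (h : lam.colLen 0 ≤ t) (v : ℕ → ℕ → Vec t) :
    colForm h (colElt lam t v) =
      ∏ j : Fin (lam.rowLen 0), topMinor (colLen_le h j) fun i : Fin (lam.colLen j) => v i j := by
  simp only [colForm, colElt, PiTensorProduct.lift.tprod, MultilinearMap.compLinearMap_apply,
    MultilinearMap.mkPiAlgebra_apply, wedgeForm_wedge]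

theorem colForm_swapCols {lam : YoungDiagram} {t : ℕ} (h : lam.colLen 0 ≤ t)
    (v : ℕ → ℕ → Vec t) (j k : ℕ) (hj : j < lam.rowLen 0) (hk : k < lam.rowLen 0)
    (hjk : lam.colLen j = lam.colLen k) :
    colForm h (colElt lam t (swapCols v j k)) = colForm h (colElt lam t v) := by
  rw [colForm_colElt, colForm_colElt, ← Equiv.prod_comp (Equiv.swap (⟨j, hj⟩ : Fin _) ⟨k, hk⟩)]
  refine Finset.prod_congr rfl fun c _ => ?_
  have hc : ((Equiv.swap (⟨j, hj⟩ : Fin _) ⟨k, hk⟩ c : Fin _) : ℕ) = Equiv.swap j k c := by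
    rw [Equiv.swap_apply_def, Equiv.swap_apply_def]
    simp only [Fin.ext_iff]
    split_ifs <;> rfl
  have hl : lam.colLen c = lam.colLen (Equiv.swap (⟨j, hj⟩ : Fin _) ⟨k, hk⟩ c : Fin _) := by
    rw [hc, Equiv.swap_apply_def]
    split_ifs with h1 h2
    · rw [h1, hjk]
    · rw [h2, hjk]
    · rfl
  rw [← topMinor_congr (colLen_le h _) (colLen_le h c) hl.symm fun i => v i c]
  simp only [swapCols, hc, Equiv.swap_apply_self]

theorem lt_rowLen_of_pos_colLen {lam : YoungDiagram} {j : ℕ} (h : 0 < lam.colLen j) :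
    j < lam.rowLen 0 :=
  YoungDiagram.mem_iff_lt_rowLen.1 (YoungDiagram.mem_iff_lt_colLen.2 h)

open Classical in
-- Apply `det_exchange` on the first `p` coordinates, with the minor of the right column regarded as
-- an alternating form in its first `r` vectors, the others being fixed. Since `q ≤ p`, this minor
-- involves only those coordinates.
theorem topMinor_exchange {p q r t : ℕ} (hp : p ≤ t) (hqp : q ≤ p) (hrq : r ≤ q)
    (v : ℕ → ℕ → Vec t) (j : ℕ) :
    (topMinor hp fun i : Fin p => v i j) * (topMinor (hqp.trans hp) fun i : Fin q => v i (j + 1)) =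
      ∑ f : {f : Fin r → Fin p // StrictMono f},
        (topMinor hp fun i : Fin p => exchange v j (fun m => (f.1 m : ℕ)) i j) *
        (topMinor (hqp.trans hp) fun i : Fin q =>
          exchange v j (fun m => (f.1 m : ℕ)) i (j + 1)) := by
  have hinj : Function.Injective (Fin.castLE hrq) := Fin.castLE_injective hrq
  have key := det_exchange (p := p) (r := r) (fun i i' => v i j (Fin.castLE hp i'))
    (fun i i' => v i (j + 1) (Fin.castLE hp i'))
    (alternatingExtend (topMinor hqp) hinj fun i i' => v i (j + 1) (Fin.castLE hp i'))
  simp only [alternatingExtend_apply] at key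
  convert key using 1
  · congr 1
    rw [topMinor_apply, topMinor_apply]
    congr 1
    ext i i'
    have : Function.extend (Fin.castLE hrq)
        (fun (i : Fin r) (i' : Fin p) => v i (j + 1) (Fin.castLE hp i'))
        (fun (i : Fin q) (i' : Fin p) => v i (j + 1) (Fin.castLE hp i')) =
        fun (i : Fin q) (i' : Fin p) => v i (j + 1) (Fin.castLE hp i') :=
      extend_comp_self hinj _
    rw [this]
    rfl
  · refine Finset.sum_congr rfl fun f _ => ?_
    congr 1
    · change Matrix.det _ = Matrix.det _
      congr 1
      ext i i'
      change exchange v j (fun m => (f.1 m : ℕ)) i j (Fin.castLE hp i') = _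
      simp only [exchange, if_true]
      have hf : Function.Injective fun m => (f.1 m : ℕ) :=
        Fin.val_injective.comp f.2.injective
      by_cases hk : ∃ m, f.1 m = i
      · obtain ⟨m, rfl⟩ := hk
        rw [f.2.injective.extend_apply, hf.extend_apply (a := m)]
      · rw [Function.extend_apply' _ _ _ hk, Function.extend_apply']
        rintro ⟨m, hm⟩
        exact hk ⟨m, Fin.ext hm⟩
    · rw [topMinor_apply, topMinor_apply]
      congr 1
      ext i i'
      simp only [exchange, Matrix.of_apply, Nat.succ_ne_self, if_false, if_true]
      by_cases hi : (i : ℕ) < r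
      · have : i = Fin.castLE hrq ⟨i, hi⟩ := rfl
        rw [dif_pos hi]
        conv_rhs => rw [this, hinj.extend_apply]
        rfl
      · rw [dif_neg hi, Function.extend_apply']
        · rfl
        · rintro ⟨m, rfl⟩
          exact hi m.2

open Classical in
theorem colForm_exchange {lam : YoungDiagram} {t : ℕ} (h : lam.colLen 0 ≤ t)
    (v : ℕ → ℕ → Vec t) (j r : ℕ) (hr : 1 ≤ r) (hrq : r ≤ lam.colLen (j + 1)) :
    colForm h (colElt lam t v) = ∑ f : {f : Fin r → Fin (lam.colLen j) // StrictMono f},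
      colForm h (colElt lam t (exchange v j fun m => (f.1 m : ℕ))) := by
  have hj1 : j + 1 < lam.rowLen 0 := lt_rowLen_of_pos_colLen (hr.trans hrq)
  let a : Fin (lam.rowLen 0) := ⟨j, by omega⟩
  let b : Fin (lam.rowLen 0) := ⟨j + 1, hj1⟩
  have hab : b ∈ Finset.univ.erase a := by simp [a, b]
  have hsplit : ∀ F : Fin (lam.rowLen 0) → ℂ,
      ∏ c, F c = (F a * F b) * ∏ c ∈ (Finset.univ.erase a).erase b, F c := by
    intro F
    rw [← Finset.mul_prod_erase _ _ (Finset.mem_univ a), ← Finset.mul_prod_erase _ _ hab, mul_assoc]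
  simp only [colForm_colElt]
  simp only [hsplit]
  rw [topMinor_exchange (colLen_le h j) (lam.colLen_anti j (j + 1) (by omega)) hrq v j,
    Finset.sum_mul]
  refine Finset.sum_congr rfl fun f _ => ?_
  congr 1
  refine Finset.prod_congr rfl fun c hc => ?_
  congr 1
  funext i
  have h1 : (c : ℕ) ≠ j + 1 := fun e => (Finset.mem_erase.1 hc).1 (Fin.ext e)
  have h2 : (c : ℕ) ≠ j := fun e =>
    (Finset.mem_erase.1 (Finset.mem_erase.1 hc).2).1 (Fin.ext e)
  simp only [exchange, h1, h2, if_false]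

theorem relations_le_ker_colForm {lam : YoungDiagram} {t : ℕ} (h : lam.colLen 0 ≤ t) :
    relations lam t ≤ LinearMap.ker (colForm h) := by
  refine Submodule.span_le.2 ?_
  rintro x (⟨v, j, k, hj, hk, hjk⟩ | ⟨v, j, r, hr, hrq⟩)
  · rw [SetLike.mem_coe, LinearMap.mem_ker, map_sub, colForm_swapCols h v j k hj hk hjk, sub_self]
  · rw [SetLike.mem_coe, LinearMap.mem_ker, map_sub, map_sum, colForm_exchange h v j r hr hrq,
      sub_self]

/-- The linear form on `W` that picks the coefficient of the highest weight vector. -/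
def highestForm {lam : YoungDiagram} {t : ℕ} (h : lam.colLen 0 ≤ t) : W lam t →ₗ[ℂ] ℂ :=
  (relations lam t).liftQ (colForm h) (relations_le_ker_colForm h)

theorem highestForm_toW {lam : YoungDiagram} {t : ℕ} (h : lam.colLen 0 ≤ t)
    (x : ColTensor lam t) : highestForm h (toW lam t x) = colForm h x := rfl

theorem entry_lt {lam : YoungDiagram} {t : ℕ} (T : Tableau lam t) (j : ℕ)
    (i : Fin (lam.colLen j)) : T.1 i j < t :=
  T.2 i j (YoungDiagram.mem_iff_lt_colLen.2 i.2)

/-- The product over the columns of a tableau of the minors of a matrix whose columns are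
given by the entries of the tableau. -/
def tabMinor {lam : YoungDiagram} {t : ℕ} (h : lam.colLen 0 ≤ t) (T : Tableau lam t)
    (A : Matrix (Fin t) (Fin t) ℂ) : ℂ :=
  ∏ j : Fin (lam.rowLen 0), (Matrix.of fun i i' : Fin (lam.colLen j) =>
    A (Fin.castLE (colLen_le h j) i') ⟨T.1 i j, entry_lt T j i⟩).det

theorem highestForm_rho_tabVec {lam : YoungDiagram} {t : ℕ} (h : lam.colLen 0 ≤ t)
    (A : Matrix (Fin t) (Fin t) ℂ) (T : Tableau lam t) :
    highestForm h (rho lam t A (tabVec T)) = tabMinor h T A := by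
  change highestForm h (rhoMap lam t A (toW lam t _)) = _
  rw [rhoMap_toW, rhoTensor_colElt, highestForm_toW, colForm_colElt, tabMinor]
  refine Finset.prod_congr rfl fun j _ => ?_
  rw [topMinor_apply]
  congr 1
  ext i i'
  have : (fun k : Fin t => if (k : ℕ) = T.1 i j then (1 : ℂ) else 0) =
      Pi.single ⟨T.1 i j, entry_lt T j i⟩ 1 := by
    funext k
    rw [Pi.single_apply]
    simp only [Fin.ext_iff]
  simp only [Matrix.of_apply, this, Matrix.mulVec_single_one, Matrix.col_apply]

/-! ### Straightening -/

/-- The element of the tensor product of the columns given by a filling of the boxes by numbers. -/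
def fillElt (lam : YoungDiagram) (t : ℕ) (g : ℕ → ℕ → ℕ) : ColTensor lam t :=
  colElt lam t fun i j k => if (k : ℕ) = g i j then 1 else 0

theorem span_fillElt (lam : YoungDiagram) (t : ℕ) :
    Submodule.span ℂ (fillElt lam t '' {g | ∀ i j, i < lam.colLen j → g i j < t}) = ⊤ := by
  let b : ∀ j : Fin (lam.rowLen 0),
      Module.Basis (Set.powersetCard (Fin t) (lam.colLen j)) ℂ (Wedge t (lam.colLen j)) :=
    fun j => (Pi.basisFun ℂ (Fin t)).exteriorPower (lam.colLen j)
  rw [eq_top_iff, ← (Basis.piTensorProduct b).span_eq, Submodule.span_le]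
  rintro _ ⟨p, rfl⟩
  refine Submodule.subset_span ⟨fun i j => if h : j < lam.rowLen 0 ∧ i < lam.colLen j then
    ((Set.powersetCard.ofFinEmbEquiv.symm (p ⟨j, h.1⟩) ⟨i, h.2⟩ : Fin t) : ℕ) else 0, ?_, ?_⟩
  · intro i j hi
    have hj := lt_rowLen_of_pos_colLen (Nat.zero_lt_of_lt hi)
    simp only [hj, hi, and_self, dif_pos]
    exact Fin.is_lt _
  · rw [Basis.piTensorProduct_apply, fillElt, colElt]
    congr 1
    funext j
    have hb : b j (p j) = exteriorPower.ιMulti_family ℂ (lam.colLen j) (Pi.basisFun ℂ (Fin t)) (p j) :=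
      exteriorPower.basis_apply _ _ _ _
    rw [hb, exteriorPower.ιMulti_family, wedge]
    congr 1
    funext i k
    simp only [Function.comp_apply, Pi.basisFun_apply, j.2, i.2, and_self, dif_pos, Pi.single_apply,
      Fin.ext_iff]

theorem fillElt_eq_zero {lam : YoungDiagram} (t : ℕ) {g : ℕ → ℕ → ℕ} {i i' j : ℕ}
    (hi : i < lam.colLen j) (hi' : i' < lam.colLen j) (hne : i ≠ i') (h : g i j = g i' j) :
    fillElt lam t g = 0 := by
  refine (PiTensorProduct.tprod ℂ).map_coord_zero
    ⟨j, lt_rowLen_of_pos_colLen (Nat.zero_lt_of_lt hi)⟩ ?_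
  refine (exteriorPower.ιMulti ℂ (lam.colLen j)).map_eq_zero_of_eq _ (i := ⟨i, hi⟩) (j := ⟨i', hi'⟩)
    ?_ (fun e => hne (Fin.ext_iff.1 e))
  simp only [h]

/-- Sorting a column costs only a sign. The sums of powers of two are symmetric in the entries of a
column, so sorting does not disturb the measure on which straightening inducts. The zeros outside
the diagram are the convention of `SemistandardYoungTableau`. -/
theorem exists_columnStrict {lam : YoungDiagram} {t : ℕ} {g : ℕ → ℕ → ℕ}
    (hg : ∀ j, Function.Injective fun i : Fin (lam.colLen j) => g i j)
    (hgt : ∀ i j, i < lam.colLen j → g i j < t) :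
    ∃ g' : ℕ → ℕ → ℕ, (∀ i j, i < lam.colLen j → g' i j < t) ∧
      (∀ i j, ¬ i < lam.colLen j → g' i j = 0) ∧
      (∀ i i' j, i < i' → i' < lam.colLen j → g' i j < g' i' j) ∧
      (∀ j, ∑ i ∈ Finset.range (lam.colLen j), 2 ^ g' i j =
        ∑ i ∈ Finset.range (lam.colLen j), 2 ^ g i j) ∧
      ∃ a : ℂ, fillElt lam t g = a • fillElt lam t g' := by
  let σ : ∀ j, Equiv.Perm (Fin (lam.colLen j)) :=
    fun j => Tuple.sort fun i : Fin (lam.colLen j) => g i j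
  let g' : ℕ → ℕ → ℕ := fun i j => if h : i < lam.colLen j then g (σ j ⟨i, h⟩) j else 0
  have hg' : ∀ j (i : Fin (lam.colLen j)), g' i j = g (σ j i) j := by
    intro j i
    simp only [g', i.2, dif_pos]
  refine ⟨g', fun i j h => ?_, fun i j h => dif_neg h, fun i i' j hi hi' => ?_, fun j => ?_, ?_⟩
  · rw [hg' j ⟨i, h⟩]; exact hgt _ _ (Fin.is_lt _)
  · have hm : StrictMono ((fun i : Fin (lam.colLen j) => g i j) ∘ σ j) :=
      (Tuple.monotone_sort _).strictMono_of_injective ((hg j).comp (σ j).injective)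
    have := @hm ⟨i, hi.trans hi'⟩ ⟨i', hi'⟩ hi
    rw [hg' j ⟨i, hi.trans hi'⟩, hg' j ⟨i', hi'⟩]
    exact this
  · rw [Finset.sum_range, Finset.sum_range, ← Equiv.sum_comp (σ j) fun i => 2 ^ g i j]
    exact Finset.sum_congr rfl fun i _ => by rw [hg']
  · refine ⟨∏ j : Fin (lam.rowLen 0), ((Equiv.Perm.sign (σ j) : ℤ) : ℂ), ?_⟩
    unfold fillElt colElt
    rw [← MultilinearMap.map_smul_univ]
    congr 1
    funext j
    have h1 := (exteriorPower.ιMulti ℂ (lam.colLen j)).map_perm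
      (fun (i : Fin (lam.colLen j)) (k : Fin t) => if (k : ℕ) = g i j then (1 : ℂ) else 0) (σ j)
    have h2 : (fun (i : Fin (lam.colLen j)) (k : Fin t) =>
        if (k : ℕ) = g' i j then (1 : ℂ) else 0) =
        (fun (i : Fin (lam.colLen j)) (k : Fin t) => if (k : ℕ) = g i j then (1 : ℂ) else 0) ∘
          σ j := by
      funext i k
      rw [hg']; rfl
    rw [h2]
    rcases Int.units_eq_one_or (Equiv.Perm.sign (σ j)) with h | h
    · rw [h, one_smul] at h1
      rw [h, Units.val_one, Int.cast_one, one_smul]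
      exact h1.symm
    · rw [h, Units.neg_smul, one_smul] at h1
      rw [h, Units.val_neg, Units.val_one, Int.cast_neg, Int.cast_one, neg_smul, one_smul,
        eq_neg_iff_add_eq_zero, add_comm, ← eq_neg_iff_add_eq_zero]
      exact h1

/-- The numerical analogue of `exchange`. -/
def exchangeFill {r : ℕ} (g : ℕ → ℕ → ℕ) (j : ℕ) (f : Fin r → ℕ) : ℕ → ℕ → ℕ :=
  fun i c =>
    if c = j then Function.extend f (fun m => g m (j + 1)) (fun i => g i j) i
    else if c = j + 1 then (if h : i < r then g (f ⟨i, h⟩) j else g i (j + 1))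
    else g i c

theorem colElt_exchange_fill (lam : YoungDiagram) (t : ℕ) {r : ℕ} (g : ℕ → ℕ → ℕ) (j : ℕ)
    (f : Fin r → ℕ) :
    colElt lam t (exchange (fun i j k => if (k : ℕ) = g i j then 1 else 0) j f) =
      fillElt lam t (exchangeFill g j f) := by
  classical
  unfold fillElt
  congr 1
  funext i c
  simp only [exchange, exchangeFill, Function.extend]
  split_ifs <;> rfl

/-- Distinct powers of two behave like binary digits: the next power above the largest one exceeds
the whole sum. -/
theorem sum_two_pow_lt {a : ℕ → ℕ} {n : ℕ} (h : ∀ i i', i < i' → i' ≤ n → a i < a i') :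
    ∑ i ∈ Finset.range (n + 1), 2 ^ a i < 2 ^ (a n + 1) := by
  induction n with
  | zero => simp [pow_succ]
  | succ n ih =>
    rw [Finset.sum_range_succ]
    have h1 := ih fun i i' hi hi' => h i i' hi (by omega)
    have h2 : 2 ^ (a n + 1) ≤ 2 ^ a (n + 1) :=
      Nat.pow_le_pow_right (by norm_num) (h n (n + 1) (by omega) le_rfl)
    rw [pow_succ]
    omega

/-- A measure of the entries of a filling in which columns to the right and large entries
dominate. -/
def fillWeight (lam : YoungDiagram) (B : ℕ) (g : ℕ → ℕ → ℕ) : ℕ :=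
  ∑ j ∈ Finset.range (lam.rowLen 0), B ^ j * ∑ i ∈ Finset.range (lam.colLen j), 2 ^ g i j

theorem columnWeight_lt {lam : YoungDiagram} {t : ℕ} {g : ℕ → ℕ → ℕ}
    (hgt : ∀ i j, i < lam.colLen j → g i j < t) (j : ℕ) :
    ∑ i ∈ Finset.range (lam.colLen j), 2 ^ g i j < lam.colLen 0 * 2 ^ t + 1 := by
  have h1 : ∑ i ∈ Finset.range (lam.colLen j), 2 ^ g i j ≤
      ∑ i ∈ Finset.range (lam.colLen j), 2 ^ t :=
    Finset.sum_le_sum fun i hi =>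
      Nat.pow_le_pow_right (by norm_num) (hgt i j (Finset.mem_range.1 hi)).le
  rw [Finset.sum_const, Finset.card_range, smul_eq_mul] at h1
  exact Nat.lt_succ_of_le (h1.trans (Nat.mul_le_mul_right _ (lam.colLen_anti 0 j (Nat.zero_le j))))

/-- At a violation in row `r`, exchange the first `r + 1` entries of the right column. Row `r` of
the right column receives the entry of row `f r ≥ r` of the left column, which exceeds `g r (j +
1)`. Its power of two alone outweighs all the `r + 1` entries that were removed. -/
theorem columnWeight_exchangeFill {q r p : ℕ} {g : ℕ → ℕ → ℕ} {j : ℕ} (hrq : r + 1 ≤ q)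
    (hp : ∀ i i', i < i' → i' < p → g i j < g i' j)
    (hq : ∀ i i', i < i' → i' < q → g i (j + 1) < g i' (j + 1))
    (hviol : g r (j + 1) < g r j) (f : Fin (r + 1) → Fin p) (hf : StrictMono f) :
    ∑ i ∈ Finset.range q, 2 ^ g i (j + 1) <
      ∑ i ∈ Finset.range q, 2 ^ exchangeFill g j (fun m => (f m : ℕ)) i (j + 1) := by
  rw [← Finset.sum_range_add_sum_Ico _ hrq, ← Finset.sum_range_add_sum_Ico _ hrq]
  have hI : ∑ i ∈ Finset.Ico (r + 1) q, 2 ^ exchangeFill g j (fun m => (f m : ℕ)) i (j + 1) =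
      ∑ i ∈ Finset.Ico (r + 1) q, 2 ^ g i (j + 1) := by
    refine Finset.sum_congr rfl fun i hi => ?_
    have : ¬ i < r + 1 := by have := Finset.mem_Ico.1 hi; omega
    simp only [exchangeFill, Nat.succ_ne_self, if_false, if_true, this, dif_neg, not_false_iff]
  rw [hI]
  refine Nat.add_lt_add_right ?_ _
  refine (sum_two_pow_lt fun i i' h h' => hq i i' h (by omega)).trans_le ?_
  have hfr : ∀ k (hk : k < r + 1), k ≤ (f ⟨k, hk⟩ : ℕ) := by
    intro k hk
    induction k with
    | zero => exact Nat.zero_le _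
    | succ k ih =>
      exact (ih (by omega)).trans_lt (hf (show (⟨k, by omega⟩ : Fin (r + 1)) < ⟨k + 1, hk⟩ from
        Nat.lt_succ_self k))
  replace hfr : r ≤ (f (Fin.last r) : ℕ) := hfr r (Nat.lt_succ_self r)
  have h1 : g r j ≤ g (f (Fin.last r)) j := by
    rcases hfr.eq_or_lt with h | h
    · rw [← h]
    · exact (hp _ _ h (Fin.is_lt _)).le
  calc 2 ^ (g r (j + 1) + 1) ≤ 2 ^ g (f (Fin.last r)) j :=
        Nat.pow_le_pow_right (by norm_num) (by omega)
    _ = 2 ^ exchangeFill g j (fun m => (f m : ℕ)) r (j + 1) := by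
        simp only [exchangeFill, Nat.succ_ne_self, if_false, if_true, Nat.lt_succ_self, dif_pos]
        rfl
    _ ≤ _ := Finset.single_le_sum
        (f := fun i => 2 ^ exchangeFill g j (fun m => (f m : ℕ)) i (j + 1))
        (fun _ _ => Nat.zero_le _) (Finset.mem_range.2 (Nat.lt_succ_self r))

/-- A gain of at least one in column `j + 1` is worth `B ^ (j + 1)`, more than everything column `j`
can lose, because its old column sum is below `B`. -/
theorem fillWeight_lt {lam : YoungDiagram} {B j : ℕ} {g g' : ℕ → ℕ → ℕ}
    (hj : j + 1 < lam.rowLen 0)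
    (h0 : ∀ i c, c ≠ j → c ≠ j + 1 → g' i c = g i c)
    (hB : ∑ i ∈ Finset.range (lam.colLen j), 2 ^ g i j < B)
    (h1 : ∑ i ∈ Finset.range (lam.colLen (j + 1)), 2 ^ g i (j + 1) <
      ∑ i ∈ Finset.range (lam.colLen (j + 1)), 2 ^ g' i (j + 1)) :
    fillWeight lam B g < fillWeight lam B g' := by
  have ha : j ∈ Finset.range (lam.rowLen 0) := Finset.mem_range.2 (by omega)
  have hb : j + 1 ∈ (Finset.range (lam.rowLen 0)).erase j := by simp [hj]
  unfold fillWeight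
  rw [← Finset.add_sum_erase _ _ ha, ← Finset.add_sum_erase _ _ hb,
    ← Finset.add_sum_erase _ _ ha, ← Finset.add_sum_erase _ _ hb, ← add_assoc, ← add_assoc]
  refine Nat.add_lt_add_of_lt_of_le ?_ (le_of_eq (Finset.sum_congr rfl fun c hc => ?_))
  · generalize ∑ i ∈ Finset.range (lam.colLen (j + 1)), 2 ^ g i (j + 1) = x at *
    generalize ∑ i ∈ Finset.range (lam.colLen (j + 1)), 2 ^ g' i (j + 1) = x' at *
    have h2 : B ^ (j + 1) * (x + 1) ≤ B ^ (j + 1) * x' := Nat.mul_le_mul_left _ h1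
    have h3 : B ^ j * ∑ i ∈ Finset.range (lam.colLen j), 2 ^ g i j < B ^ (j + 1) := by
      rw [pow_succ]
      exact Nat.mul_lt_mul_of_pos_left hB (Nat.pow_pos (Nat.zero_lt_of_lt hB))
    rw [mul_add, mul_one] at h2
    omega
  · have h1 := (Finset.mem_erase.1 hc).1
    have h2 := (Finset.mem_erase.1 (Finset.mem_erase.1 hc).2).1
    simp only [h0 _ c h2 h1]

theorem fillWeight_le {lam : YoungDiagram} {t : ℕ} {g : ℕ → ℕ → ℕ}
    (hgt : ∀ i j, i < lam.colLen j → g i j < t) (B : ℕ) :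
    fillWeight lam B g ≤ ∑ j ∈ Finset.range (lam.rowLen 0), B ^ j * (lam.colLen 0 * 2 ^ t + 1) :=
  Finset.sum_le_sum fun j _ => Nat.mul_le_mul_left _ (columnWeight_lt hgt j).le

/-- A column strict filling with weakly increasing rows as a semistandard tableau. -/
def tableauOfFill {lam : YoungDiagram} {t : ℕ} (g : ℕ → ℕ → ℕ)
    (hgt : ∀ i j, i < lam.colLen j → g i j < t)
    (hz : ∀ i j, ¬ i < lam.colLen j → g i j = 0)
    (hc : ∀ i i' j, i < i' → i' < lam.colLen j → g i j < g i' j)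
    (hr : ∀ i j, i < lam.colLen (j + 1) → g i j ≤ g i (j + 1)) : Tableau lam t :=
  ⟨{ entry := g
     row_weak' := by
      intro i j1 j2 hj hm
      induction j2, hj using Nat.le_induction with
      | base => exact hr i j1 (YoungDiagram.mem_iff_lt_colLen.1 hm)
      | succ j hj ih =>
        exact (ih (lam.up_left_mem le_rfl (Nat.le_succ j) hm)).trans
          (hr i j (YoungDiagram.mem_iff_lt_colLen.1 hm))
     col_strict' := fun hi hm => hc _ _ _ hi (YoungDiagram.mem_iff_lt_colLen.1 hm)
     zeros' := fun hm => hz _ _ fun h => hm (YoungDiagram.mem_iff_lt_colLen.2 h) },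
    fun i j hm => hgt i j (YoungDiagram.mem_iff_lt_colLen.1 hm)⟩

theorem exchangeFill_lt {lam : YoungDiagram} {t r j : ℕ} {g : ℕ → ℕ → ℕ}
    (hgt : ∀ i j, i < lam.colLen j → g i j < t) (hrq : r ≤ lam.colLen (j + 1))
    (f : Fin r → Fin (lam.colLen j)) (i c : ℕ) (hi : i < lam.colLen c) :
    exchangeFill g j (fun m => (f m : ℕ)) i c < t := by
  classical
  simp only [exchangeFill, Function.extend]
  split_ifs with h1 h2 h3 h4
  · exact hgt _ _ ((Fin.is_lt _).trans_le hrq)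
  · exact hgt _ _ (h1 ▸ hi)
  · exact hgt _ _ (Fin.is_lt _)
  · exact hgt _ _ (h3 ▸ hi)
  · exact hgt _ _ hi

theorem toW_fillElt_mem (lam : YoungDiagram) (t : ℕ) (g : ℕ → ℕ → ℕ)
    (hgt : ∀ i j, i < lam.colLen j → g i j < t) :
    toW lam t (fillElt lam t g) ∈
      Submodule.span ℂ (Set.range (tabVec : Tableau lam t → W lam t)) := by
  set B := lam.colLen 0 * 2 ^ t + 1 with hB
  -- Each exchange at a violation strictly raises `fillWeight`, which is bounded for entries below
  -- `t`; the induction is on the distance to this bound.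
  induction hm : (∑ j ∈ Finset.range (lam.rowLen 0), B ^ j * B) - fillWeight lam B g
    using Nat.strong_induction_on generalizing g with
  | _ m ih =>
  by_cases hinj : ∀ j, Function.Injective fun i : Fin (lam.colLen j) => g i j
  swap
  · push Not at hinj
    obtain ⟨j, hj⟩ := hinj
    simp only [Function.Injective, not_forall] at hj
    obtain ⟨i, i', h, hne⟩ := hj
    rw [fillElt_eq_zero t i.2 i'.2 (fun e => hne (Fin.ext e)) h, map_zero]
    exact Submodule.zero_mem _
  obtain ⟨g', hgt', hz, hc, hw, a, ha⟩ := exists_columnStrict hinj hgt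
  rw [ha, map_smul]
  refine Submodule.smul_mem _ _ ?_
  have hw' : fillWeight lam B g' = fillWeight lam B g :=
    Finset.sum_congr rfl fun j _ => by rw [hw]
  rw [← hw'] at hm
  by_cases hr : ∀ i j, i < lam.colLen (j + 1) → g' i j ≤ g' i (j + 1)
  · exact Submodule.subset_span ⟨tableauOfFill g' hgt' hz hc hr, rfl⟩
  push Not at hr
  obtain ⟨r, j, hrj, hviol⟩ := hr
  classical
  have hrel : toW lam t (fillElt lam t g') =
      ∑ f : {f : Fin (r + 1) → Fin (lam.colLen j) // StrictMono f},
        toW lam t (fillElt lam t (exchangeFill g' j fun m => (f.1 m : ℕ))) := by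
    have h1 := Submodule.subset_span (R := ℂ) (IsRelation.exch (lam := lam) (t := t)
      (fun i j k => if (k : ℕ) = g' i j then 1 else 0) j (r + 1) (Nat.succ_pos r) hrj)
    have h2 := (Submodule.Quotient.mk_eq_zero (relations lam t)).2 h1
    simp only [colElt_exchange_fill] at h2
    rw [← map_sum, ← sub_eq_zero, ← map_sub]
    refine Eq.trans ?_ h2
    congr!
  rw [hrel]
  refine Submodule.sum_mem _ fun f _ => ih _ ?_ _ (exchangeFill_lt hgt' hrj f.1) rfl
  have hlt : fillWeight lam B g' <
      fillWeight lam B (exchangeFill g' j fun m => (f.1 m : ℕ)) := by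
    refine fillWeight_lt (lt_rowLen_of_pos_colLen (Nat.zero_lt_of_lt hrj))
      (fun i c h1 h2 => by simp only [exchangeFill, h1, h2, if_false]) (columnWeight_lt hgt' j) ?_
    exact columnWeight_exchangeFill hrj
      (fun i i' => hc i i' j) (fun i i' => hc i i' (j + 1)) hviol f.1 f.2
  have hle := fillWeight_le (exchangeFill_lt hgt' hrj f.1) B
  rw [← hm]
  exact Nat.sub_lt_sub_left (hlt.trans_le hle) hlt

/-- The vectors `e_T`, `T` semistandard, span `W`. -/
theorem span_tabVec (lam : YoungDiagram) (t : ℕ) :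
    Submodule.span ℂ (Set.range (tabVec : Tableau lam t → W lam t)) = ⊤ := by
  rw [eq_top_iff, ← LinearMap.range_eq_top.2 (toW_surjective lam t), LinearMap.range_eq_map,
    ← span_fillElt, Submodule.map_span, Submodule.span_le]
  rintro _ ⟨_, ⟨g, hg, rfl⟩, rfl⟩
  exact toW_fillElt_mem lam t g hg

/-! ### Linear independence of the products of minors -/

/-- The weight of a monomial in the matrix entries, the `(i, k)` entry having weight `i * k`. -/
def entryWeight {t : ℕ} : (Fin t × Fin t →₀ ℕ) →+ ℕ :=
  Finsupp.weight fun x : Fin t × Fin t => (x.1 : ℕ) * x.2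

/-- The polynomial `P` has the leading monomial `m`, with coefficient one, for `entryWeight`. -/
def IsLeading {t : ℕ} (P : MvPolynomial (Fin t × Fin t) ℂ) (m : Fin t × Fin t →₀ ℕ) : Prop :=
  P.coeff m = 1 ∧ ∀ m', P.coeff m' ≠ 0 → m' = m ∨ entryWeight m' < entryWeight m

theorem IsLeading.le {t : ℕ} {P : MvPolynomial (Fin t × Fin t) ℂ} {m m' : Fin t × Fin t →₀ ℕ}
    (h : IsLeading P m) (hm' : P.coeff m' ≠ 0) : entryWeight m' ≤ entryWeight m := by
  rcases h.2 m' hm' with rfl | h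
  · exact le_rfl
  · exact h.le

theorem isLeading_one {t : ℕ} : IsLeading (1 : MvPolynomial (Fin t × Fin t) ℂ) 0 := by
  refine ⟨by simp, fun m' h => Or.inl ?_⟩
  by_contra hne
  exact h (by rw [MvPolynomial.coeff_one, if_neg (Ne.symm hne)])

theorem IsLeading.mul {t : ℕ} {P Q : MvPolynomial (Fin t × Fin t) ℂ}
    {m k : Fin t × Fin t →₀ ℕ} (hP : IsLeading P m) (hQ : IsLeading Q k) :
    IsLeading (P * Q) (m + k) := by
  constructor
  · rw [MvPolynomial.coeff_mul, Finset.sum_eq_single (m, k)]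
    · rw [hP.1, hQ.1, one_mul]
    · rintro ⟨a, b⟩ hab hne
      by_contra h
      have ha : P.coeff a ≠ 0 := left_ne_zero_of_mul h
      have hb : Q.coeff b ≠ 0 := right_ne_zero_of_mul h
      have hsum : a + b = m + k := Finset.HasAntidiagonal.mem_antidiagonal.1 hab
      have hw := congrArg entryWeight hsum
      rw [map_add, map_add] at hw
      have h1 := hP.le ha
      have h2 := hQ.le hb
      rcases hP.2 a ha with rfl | h3
      · rcases hQ.2 b hb with rfl | h4
        · exact hne rfl
        · omega
      · omega
    · exact fun h => absurd (by simp) h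
  · intro m' hm'
    rw [MvPolynomial.coeff_mul] at hm'
    obtain ⟨⟨a, b⟩, hab, h⟩ := Finset.exists_ne_zero_of_sum_ne_zero hm'
    have ha : P.coeff a ≠ 0 := left_ne_zero_of_mul h
    have hb : Q.coeff b ≠ 0 := right_ne_zero_of_mul h
    have hsum : a + b = m' := Finset.HasAntidiagonal.mem_antidiagonal.1 hab
    have h1 := hP.le ha
    have h2 := hQ.le hb
    rw [← hsum, map_add, map_add]
    rcases hP.2 a ha with rfl | h3
    · rcases hQ.2 b hb with rfl | h4
      · exact Or.inl rfl
      · right; omega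
    · right; omega

theorem isLeading_prod {t : ℕ} {α : Type*} (s : Finset α)
    (P : α → MvPolynomial (Fin t × Fin t) ℂ) (m : α → Fin t × Fin t →₀ ℕ)
    (h : ∀ a ∈ s, IsLeading (P a) (m a)) : IsLeading (∏ a ∈ s, P a) (∑ a ∈ s, m a) := by
  classical
  induction s using Finset.induction_on with
  | empty => exact isLeading_one
  | insert a s ha ih =>
    rw [Finset.prod_insert ha, Finset.sum_insert ha]
    exact (h a (Finset.mem_insert_self a s)).mul
      (ih fun b hb => h b (Finset.mem_insert_of_mem hb))

/-- The strict rearrangement inequality: equality would make `σ⁻¹` increasing, hence the identity.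
-/
theorem perm_sum_lt {p t : ℕ} {a c : Fin p → Fin t} (ha : StrictMono a) (hc : StrictMono c)
    {σ : Equiv.Perm (Fin p)} (hσ : σ ≠ 1) :
    ∑ i, (a i : ℕ) * (c (σ i) : ℕ) < ∑ i, (a i : ℕ) * (c i : ℕ) := by
  have hmono : Monovary (fun i => (a i : ℕ)) (fun i => (c i : ℕ)) := fun i j hij =>
    (ha.monotone (hc.lt_iff_lt.1 hij).le : a i ≤ a j)
  rw [hmono.sum_mul_comp_perm_lt_sum_mul_iff]
  intro h
  apply hσ
  have hs : StrictMono σ.symm := by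
    intro i j hij
    refine lt_of_le_of_ne ?_ (σ.symm.injective.ne hij.ne)
    refine ha.le_iff_le.1 (h ?_ : (a (σ.symm i) : ℕ) ≤ a (σ.symm j))
    simpa using hc hij
  have : (σ.symm : Fin p → Fin p) = id :=
    (hs.range_inj strictMono_id).1 (by rw [σ.symm.surjective.range_eq, Set.range_id])
  ext i
  have := congrFun this (σ i)
  simp at this
  rw [← this]; rfl

/-- The terms of the determinant are indexed by permutations. With the `(i, k)` entry of weight `i *
k`, the rearrangement inequality makes the diagonal term the unique heaviest one. -/
theorem isLeading_det {p t : ℕ} {a c : Fin p → Fin t} (ha : StrictMono a) (hc : StrictMono c) :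
    IsLeading (Matrix.of fun i i' : Fin p =>
      (MvPolynomial.X (a i', c i) : MvPolynomial (Fin t × Fin t) ℂ)).det
      (∑ i, Finsupp.single (a i, c i) 1) := by
  have hw : ∀ σ : Equiv.Perm (Fin p),
      entryWeight (∑ i, Finsupp.single (a i, c (σ i)) 1) = ∑ i, (a i : ℕ) * (c (σ i) : ℕ) := by
    intro σ
    rw [map_sum]
    refine Finset.sum_congr rfl fun i _ => ?_
    simp [entryWeight, Finsupp.weight_single]
  have hcoeff : ∀ m, (Matrix.of fun i i' : Fin p =>
      (MvPolynomial.X (a i', c i) : MvPolynomial (Fin t × Fin t) ℂ)).det.coeff m =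
      ∑ σ : Equiv.Perm (Fin p), ((Equiv.Perm.sign σ : ℤ) : ℂ) *
        if ∑ i, Finsupp.single (a i, c (σ i)) 1 = m then 1 else 0 := by
    intro m
    rw [Matrix.det_apply', MvPolynomial.coeff_sum]
    refine Finset.sum_congr rfl fun σ _ => ?_
    have h1 : ∏ i, Matrix.of (fun i i' : Fin p =>
        (MvPolynomial.X (a i', c i) : MvPolynomial (Fin t × Fin t) ℂ)) (σ i) i =
        MvPolynomial.monomial (∑ i, Finsupp.single (a i, c (σ i)) 1) 1 := by
      rw [MvPolynomial.monomial_sum_one]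
      rfl
    have h2 : (((Equiv.Perm.sign σ : ℤ) : MvPolynomial (Fin t × Fin t) ℂ)) =
        MvPolynomial.C ((Equiv.Perm.sign σ : ℤ) : ℂ) := by simp
    rw [h1, h2, MvPolynomial.coeff_C_mul, MvPolynomial.coeff_monomial]
  constructor
  · rw [hcoeff, Finset.sum_eq_single 1]
    · simp
    · intro σ _ hσ
      rw [if_neg, mul_zero]
      intro h
      have h1 := hw σ
      have h2 := hw 1
      simp only [Equiv.Perm.one_apply] at h2
      rw [h, h2] at h1
      exact absurd h1 (perm_sum_lt ha hc hσ).ne'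
    · simp
  · intro m' hm'
    rw [hcoeff] at hm'
    obtain ⟨σ, -, hσ⟩ := Finset.exists_ne_zero_of_sum_ne_zero hm'
    have hm : ∑ i, Finsupp.single (a i, c (σ i)) 1 = m' := by
      by_contra h
      exact hσ (by rw [if_neg h, mul_zero])
    by_cases h1 : σ = 1
    · left; rw [← hm, h1]; rfl
    · right
      have h2 := hw 1
      simp only [Equiv.Perm.one_apply] at h2
      rw [← hm, hw, h2]
      exact perm_sum_lt ha hc h1

/-! ### Products of minors attached to tableaux, and their leading monomials -/

section Tableau

variable {lam : YoungDiagram} {t : ℕ}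

/-- The entries of a tableau in column `j`. -/
def colEntry (T : Tableau lam t) (j : ℕ) (i : Fin (lam.colLen j)) : Fin t :=
  ⟨T.1 i j, entry_lt T j i⟩

theorem colEntry_strictMono (T : Tableau lam t) (j : ℕ) : StrictMono (colEntry T j) :=
  fun _ i' h => T.1.col_strict h (YoungDiagram.mem_iff_lt_colLen.2 i'.2)

/-- `tabMinor` as a polynomial in the entries of the matrix. -/
def tabPoly (h : lam.colLen 0 ≤ t) (T : Tableau lam t) : MvPolynomial (Fin t × Fin t) ℂ :=
  ∏ j : Fin (lam.rowLen 0), (Matrix.of fun i i' : Fin (lam.colLen j) =>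
    MvPolynomial.X (Fin.castLE (colLen_le h j) i', colEntry T j i)).det

theorem eval_tabPoly (h : lam.colLen 0 ≤ t) (T : Tableau lam t) (A : Matrix (Fin t) (Fin t) ℂ) :
    MvPolynomial.eval (fun x => A x.1 x.2) (tabPoly h T) = tabMinor h T A := by
  rw [tabPoly, map_prod, tabMinor]
  refine Finset.prod_congr rfl fun j _ => ?_
  rw [RingHom.map_det]
  congr 1
  ext i i'
  simp [colEntry]

/-- The leading monomial of `tabPoly`. -/
def tabMonomial (h : lam.colLen 0 ≤ t) (T : Tableau lam t) : Fin t × Fin t →₀ ℕ :=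
  ∑ j : Fin (lam.rowLen 0), ∑ i : Fin (lam.colLen j),
    Finsupp.single (Fin.castLE (colLen_le h j) i, colEntry T j i) 1

theorem isLeading_tabPoly (h : lam.colLen 0 ≤ t) (T : Tableau lam t) :
    IsLeading (tabPoly h T) (tabMonomial h T) :=
  isLeading_prod _ _ _ fun j _ =>
    isLeading_det (Fin.strictMono_castLE _) (colEntry_strictMono T j)

/-- The leading monomial records the content of each row, and the rows of a tableau are sorted, so
it determines the tableau. -/
theorem tabMonomial_apply (h : lam.colLen 0 ≤ t) (T : Tableau lam t) (i k : Fin t) :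
    tabMonomial h T (i, k) = ((List.range (lam.rowLen i)).map (T.1 i)).count (k : ℕ) := by
  have h1 : ((List.range (lam.rowLen i)).map (T.1 i)).count (k : ℕ) =
      ∑ j ∈ Finset.range (lam.rowLen i), if T.1 i j = k then 1 else 0 := by
    generalize lam.rowLen i = n
    induction n with
    | zero => simp
    | succ n ih =>
      rw [List.range_succ, List.map_append, List.count_append, ih, Finset.sum_range_succ]
      simp [List.count_singleton]
  have h2 : ∑ j ∈ Finset.range (lam.rowLen i), (if T.1 i j = k then 1 else 0) =
      ∑ j ∈ Finset.range (lam.rowLen 0), if (i : ℕ) < lam.colLen j ∧ T.1 i j = k then 1 else 0 := by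
    rw [← Finset.sum_filter, ← Finset.sum_filter]
    congr 1
    ext j
    have h3 : j < lam.rowLen i ↔ (i : ℕ) < lam.colLen j :=
      YoungDiagram.mem_iff_lt_rowLen.symm.trans YoungDiagram.mem_iff_lt_colLen
    have h4 : j < lam.rowLen i → j < lam.rowLen 0 :=
      fun h => h.trans_le (lam.rowLen_anti 0 i (Nat.zero_le _))
    simp only [Finset.mem_filter, Finset.mem_range, ← h3]
    tauto
  rw [h1, h2, Finset.sum_range, tabMonomial, Finsupp.finsetSum_apply]
  refine Finset.sum_congr rfl fun j _ => ?_
  rw [Finsupp.finsetSum_apply]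
  simp only [Finsupp.single_apply, Prod.mk.injEq]
  by_cases hi : (i : ℕ) < lam.colLen j
  · rw [Finset.sum_eq_single ⟨i, hi⟩]
    · have h3 : Fin.castLE (colLen_le h j) ⟨(i : ℕ), hi⟩ = i := rfl
      simp [h3, hi, colEntry, Fin.ext_iff]
    · intro b _ hb
      rw [if_neg]
      rintro ⟨rfl, -⟩
      exact hb rfl
    · simp
  · rw [if_neg (fun h => hi h.1)]
    refine Finset.sum_eq_zero fun b _ => if_neg ?_
    rintro ⟨rfl, -⟩
    exact hi b.2

theorem tabMonomial_injective (h : lam.colLen 0 ≤ t) :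
    Function.Injective (tabMonomial h : Tableau lam t → _) := by
  intro T S hTS
  have hlist : ∀ i, i < t → (List.range (lam.rowLen i)).map (T.1 i) =
      (List.range (lam.rowLen i)).map (S.1 i) := by
    intro i hi
    have hsorted : ∀ U : Tableau lam t,
        ((List.range (lam.rowLen i)).map (U.1 i)).Pairwise (· ≤ ·) := by
      intro U
      rw [List.pairwise_map]
      refine List.Pairwise.imp_of_mem ?_ List.pairwise_lt_range
      intro a b _ hb hab
      exact U.1.row_weak hab (YoungDiagram.mem_iff_lt_rowLen.2 (List.mem_range.1 hb))
    refine List.Perm.eq_of_pairwise ?_ (hsorted T) (hsorted S) ?_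
    · intro a b _ _; exact le_antisymm
    · rw [List.perm_iff_count]
      intro k
      by_cases hk : k < t
      · have := DFunLike.congr_fun hTS (⟨i, hi⟩, ⟨k, hk⟩)
        rwa [tabMonomial_apply, tabMonomial_apply] at this
      · have h0 : ∀ U : Tableau lam t, ((List.range (lam.rowLen i)).map (U.1 i)).count k = 0 := by
          intro U
          rw [List.count_eq_zero]
          intro hm
          obtain ⟨j, hj, rfl⟩ := List.mem_map.1 hm
          exact hk (U.2 i j (YoungDiagram.mem_iff_lt_rowLen.2 (List.mem_range.1 hj)))
        rw [h0, h0]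
  refine Subtype.ext (SemistandardYoungTableau.ext fun i j => ?_)
  by_cases hij : (i, j) ∈ lam
  · have hi : i < t := (YoungDiagram.mem_iff_lt_colLen.1 hij).trans_le (colLen_le h j)
    exact List.map_inj_left.1 (hlist i hi) j
      (List.mem_range.2 (YoungDiagram.mem_iff_lt_rowLen.1 hij))
  · rw [T.1.zeros hij, S.1.zeros hij]

theorem tabMinor_independent (h : lam.colLen 0 ≤ t) (a : Tableau lam t →₀ ℂ)
    (ha : ∀ A : Matrix (Fin t) (Fin t) ℂ, A.det ≠ 0 → (a.sum fun T z => z * tabMinor h T A) = 0) :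
    a = 0 := by
  by_contra hne
  have hP : (a.sum fun T z => MvPolynomial.C z * tabPoly h T) = 0 := by
    -- Multiplication by the generic determinant makes the polynomial vanish at singular matrices as
    -- well, and the determinant can then be cancelled.
    let G : Matrix (Fin t) (Fin t) (MvPolynomial (Fin t × Fin t) ℂ) :=
      Matrix.of fun i k => MvPolynomial.X (i, k)
    have hG : G.det ≠ 0 := Matrix.det_mvPolynomialX_ne_zero (Fin t) ℂ
    refine (mul_eq_zero.1 (MvPolynomial.funext fun x => ?_)).resolve_right hG
    rw [map_mul, map_zero]
    have hdet : MvPolynomial.eval x G.det = (Matrix.of fun i k => x (i, k)).det := by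
      rw [RingHom.map_det]
      congr 1
      ext i k
      simp [G]
    rw [hdet]
    by_cases hx : (Matrix.of fun i k => x (i, k)).det = 0
    · rw [hx, mul_zero]
    · rw [Finsupp.sum, map_sum]
      have := ha _ hx
      rw [Finsupp.sum] at this
      convert zero_mul _ using 2
      rw [← this]
      refine Finset.sum_congr rfl fun T _ => ?_
      rw [map_mul, MvPolynomial.eval_C, ← eval_tabPoly]
      rfl
  -- For a tableau of greatest weight in the support, no other product of minors contains its
  -- leading monomial, so its coefficient must vanish.
  obtain ⟨T, hT, hmax⟩ := a.support.exists_max_image (fun T => entryWeight (tabMonomial h T))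
    (Finsupp.support_nonempty_iff.2 hne)
  have hc := congrArg (MvPolynomial.coeff (tabMonomial h T)) hP
  rw [Finsupp.sum, MvPolynomial.coeff_sum, Finset.sum_eq_single T, MvPolynomial.coeff_C_mul,
    (isLeading_tabPoly h T).1, mul_one, MvPolynomial.coeff_zero] at hc
  · exact Finsupp.mem_support_iff.1 hT hc
  · intro S hS hST
    rw [MvPolynomial.coeff_C_mul]
    by_contra h0
    rcases (isLeading_tabPoly h S).2 _ (right_ne_zero_of_mul h0) with h1 | h1
    · exact hST (tabMonomial_injective h h1).symm
    · exact absurd (hmax S hS) (not_le.2 h1)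
  · exact fun h => absurd hT h

end Tableau

/-! ### Separation by unitary matrices -/

/-- A coincidence of powers would make `π` rational. Thus one element of the unit circle already
distinguishes all weights. -/
theorem exp_I_pow_injective : Function.Injective fun n : ℕ => Complex.exp Complex.I ^ n := by
  intro m n hmn
  simp only [← Complex.exp_nat_mul] at hmn
  obtain ⟨k, hk⟩ := Complex.exp_eq_exp_iff_exists_int.1 hmn
  have h1 : ((m : ℝ) : ℂ) = ((n + k * (2 * Real.pi) : ℝ) : ℂ) := by
    apply mul_right_cancel₀ Complex.I_ne_zero
    push_cast
    rw [hk]; ring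
  have h2 : (m : ℝ) = n + k * (2 * Real.pi) := Complex.ofReal_injective h1
  by_cases hk0 : k = 0
  · rw [hk0] at h2
    simpa using h2
  · exfalso
    have h3 : Real.pi = (((m - n : ℤ) / (2 * k : ℤ) : ℚ) : ℝ) := by
      have : (k : ℝ) ≠ 0 := by exact_mod_cast hk0
      push_cast
      field_simp
      linarith
    exact irrational_pi ⟨_, h3.symm⟩

theorem norm_exp_I : ‖Complex.exp Complex.I‖ = 1 := by
  simpa using Complex.norm_exp_ofReal_mul_I 1

theorem infinite_unitCircle : {z : ℂ | ‖z‖ = 1}.Infinite := by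
  refine Set.infinite_of_injective_forall_mem exp_I_pow_injective fun n => ?_
  change ‖Complex.exp Complex.I ^ n‖ = 1
  rw [norm_pow, norm_exp_I, one_pow]

theorem diagonal_mem_unitaryGroup {t : ℕ} {z : Fin t → ℂ} (hz : ∀ i, ‖z i‖ = 1) :
    Matrix.diagonal z ∈ Matrix.unitaryGroup (Fin t) ℂ := by
  rw [Matrix.mem_unitaryGroup_iff, Matrix.star_eq_conjTranspose, Matrix.diagonal_conjTranspose,
    Matrix.diagonal_mul_diagonal, ← Matrix.diagonal_one]
  congr 1
  funext i
  have := Complex.mul_conj (z i)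
  rw [Complex.normSq_eq_norm_sq, hz i] at this
  simpa using this

/-- An invertible matrix is a product of a unitary, a diagonal and a unitary matrix. -/
theorem exists_unitary_diagonal {t : ℕ} (A : Matrix (Fin t) (Fin t) ℂ) (hA : A.det ≠ 0) :
    ∃ U ∈ Matrix.unitaryGroup (Fin t) ℂ, ∃ V ∈ Matrix.unitaryGroup (Fin t) ℂ,
      ∃ z : Fin t → ℂ, A = U * Matrix.diagonal z * V := by
  have hH := Matrix.isHermitian_conjTranspose_mul_self A
  have hP : (Aᴴ * A).PosDef := by
    refine Matrix.PosDef.conjTranspose_mul_self A ?_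
    exact Matrix.mulVec_injective_of_isUnit ((Matrix.isUnit_iff_isUnit_det A).2 hA.isUnit)
  let E : Matrix (Fin t) (Fin t) ℂ := hH.eigenvectorUnitary
  have hE : E ∈ Matrix.unitaryGroup (Fin t) ℂ := hH.eigenvectorUnitary.2
  have hE1 : E * Eᴴ = 1 := Matrix.mem_unitaryGroup_iff.1 hE
  have hE2 : Eᴴ * E = 1 := Matrix.mem_unitaryGroup_iff'.1 hE
  let s : Fin t → ℝ := fun i => Real.sqrt (hH.eigenvalues i)
  have hs : ∀ i, 0 < s i := fun i => Real.sqrt_pos.2 (hP.eigenvalues_pos i)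
  have hspec : Eᴴ * (Aᴴ * A) * E = Matrix.diagonal fun i => ((s i * s i : ℝ) : ℂ) := by
    have h1 : Aᴴ * A = E * Matrix.diagonal (fun i => ((hH.eigenvalues i : ℝ) : ℂ)) * Eᴴ := by
      conv_lhs => rw [hH.spectral_theorem]
      rfl
    have h2 : (fun i => ((s i * s i : ℝ) : ℂ)) = fun i => ((hH.eigenvalues i : ℝ) : ℂ) := by
      funext i
      rw [Real.mul_self_sqrt (hP.eigenvalues_pos i).le]
    rw [h1, h2]
    simp only [← mul_assoc]
    rw [hE2, one_mul, mul_assoc, hE2, mul_one]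
  -- The singular value decomposition: `E` diagonalizes `Aᴴ * A`, the `s i` are the singular values,
  -- and dividing the orthogonal columns of `A * E` by their lengths gives a unitary matrix.
  refine ⟨A * E * Matrix.diagonal fun i => (((s i)⁻¹ : ℝ) : ℂ), ?_, Eᴴ,
    Unitary.star_mem hE, fun i => ((s i : ℝ) : ℂ), ?_⟩
  · rw [Matrix.mem_unitaryGroup_iff', Matrix.star_eq_conjTranspose, Matrix.conjTranspose_mul,
      Matrix.conjTranspose_mul]
    have : (Matrix.diagonal fun i => (((s i)⁻¹ : ℝ) : ℂ))ᴴ * (Eᴴ * Aᴴ) *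
        (A * E * Matrix.diagonal fun i => (((s i)⁻¹ : ℝ) : ℂ)) =
        (Matrix.diagonal fun i => (((s i)⁻¹ : ℝ) : ℂ))ᴴ * (Eᴴ * (Aᴴ * A) * E) *
          Matrix.diagonal fun i => (((s i)⁻¹ : ℝ) : ℂ) := by
      simp only [mul_assoc]
    rw [this, hspec, Matrix.diagonal_conjTranspose, Matrix.diagonal_mul_diagonal,
      Matrix.diagonal_mul_diagonal, ← Matrix.diagonal_one]
    congr 1
    funext i
    have := (hs i).ne'
    simp only [Pi.star_apply, RCLike.star_def, Complex.conj_ofReal]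
    rw [← Complex.ofReal_mul, ← Complex.ofReal_mul]
    field_simp
    simp
  · rw [mul_assoc (A * E), Matrix.diagonal_mul_diagonal]
    have : (fun i => (((s i)⁻¹ : ℝ) : ℂ) * ((s i : ℝ) : ℂ)) = fun _ => 1 := by
      funext i
      rw [← Complex.ofReal_mul, inv_mul_cancel₀ (hs i).ne', Complex.ofReal_one]
    rw [this, Matrix.diagonal_one, mul_one, mul_assoc, hE1, mul_one]

/-! ### Unitary translates of the highest weight functional span the dual of `W` -/

section Separation

variable {lam : YoungDiagram} {t : ℕ}

/-- Write `A = U diag(z) V`. For fixed `U` and `V` the sum is a polynomial in `z` that vanishes on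
the torus `|z i| = 1`, a product of infinite sets, hence vanishes identically. -/
theorem sum_tabMinor_eq_zero_of_unitary (h : lam.colLen 0 ≤ t) (a : Tableau lam t →₀ ℂ)
    (ha : ∀ u ∈ Matrix.unitaryGroup (Fin t) ℂ, (a.sum fun T z => z * tabMinor h T u) = 0)
    (A : Matrix (Fin t) (Fin t) ℂ) (hA : A.det ≠ 0) :
    (a.sum fun T z => z * tabMinor h T A) = 0 := by
  obtain ⟨U, hU, V, hV, z, rfl⟩ := exists_unitary_diagonal A hA
  let P : MvPolynomial (Fin t) ℂ := a.sum fun T c => MvPolynomial.C c *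
    MvPolynomial.bind₁ (fun x : Fin t × Fin t =>
      ∑ l, MvPolynomial.C (U x.1 l * V l x.2) * MvPolynomial.X l) (tabPoly h T)
  have hP : ∀ x : Fin t → ℂ, MvPolynomial.eval x P =
      a.sum fun T c => c * tabMinor h T (U * Matrix.diagonal x * V) := by
    intro x
    simp only [P, Finsupp.sum, map_sum]
    refine Finset.sum_congr rfl fun T _ => ?_
    rw [map_mul, MvPolynomial.eval_C, ← eval_tabPoly]
    unfold MvPolynomial.eval
    rw [MvPolynomial.eval₂Hom_bind₁]
    congr 3
    funext y
    rw [Matrix.mul_apply]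
    simp only [map_sum, map_mul, MvPolynomial.eval₂Hom_C, MvPolynomial.eval₂Hom_X',
      Matrix.mul_diagonal, RingHom.id_apply]
    exact Finset.sum_congr rfl fun l _ => by ring
  have hP0 : P = 0 := by
    refine MvPolynomial.funext_set (fun _ => {z : ℂ | ‖z‖ = 1}) (fun _ => infinite_unitCircle)
      fun x hx => ?_
    rw [hP, map_zero]
    refine ha _ (mul_mem (mul_mem hU (diagonal_mem_unitaryGroup fun i => ?_)) hV)
    exact hx i (Set.mem_univ i)
  rw [← hP, hP0, map_zero]

theorem highestForm_rho_finsupp (h : lam.colLen 0 ≤ t) (a : Tableau lam t →₀ ℂ)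
    (A : Matrix (Fin t) (Fin t) ℂ) :
    highestForm h (rho lam t A (a.sum fun T z => z • tabVec T)) =
      a.sum fun T z => z * tabMinor h T A := by
  simp only [Finsupp.sum, map_sum, map_smul, highestForm_rho_tabVec, smul_eq_mul]

theorem exists_eq_sum_tabVec (w : W lam t) :
    ∃ a : Tableau lam t →₀ ℂ, (a.sum fun T z => z • tabVec T) = w :=
  Finsupp.mem_span_range_iff_exists_finsupp.1 (span_tabVec lam t ▸ Submodule.mem_top)

theorem finsupp_eq_zero_of_unitary (h : lam.colLen 0 ≤ t) (a : Tableau lam t →₀ ℂ)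
    (hw : ∀ u ∈ Matrix.unitaryGroup (Fin t) ℂ,
      highestForm h (rho lam t u (a.sum fun T z => z • tabVec T)) = 0) : a = 0 := by
  refine tabMinor_independent h a (sum_tabMinor_eq_zero_of_unitary h a fun u hu => ?_)
  rw [← highestForm_rho_finsupp]
  exact hw u hu

theorem linearIndependent_tabVec (h : lam.colLen 0 ≤ t) :
    LinearIndependent ℂ (tabVec : Tableau lam t → W lam t) := by
  rw [linearIndependent_iff]
  intro a ha
  refine finsupp_eq_zero_of_unitary h a fun u _ => ?_
  rw [Finsupp.linearCombination_apply] at ha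
  rw [ha, map_zero, map_zero]

theorem eq_zero_of_unitary (h : lam.colLen 0 ≤ t) (w : W lam t)
    (hw : ∀ u ∈ Matrix.unitaryGroup (Fin t) ℂ, highestForm h (rho lam t u w) = 0) : w = 0 := by
  obtain ⟨a, rfl⟩ := exists_eq_sum_tabVec w
  rw [finsupp_eq_zero_of_unitary h a hw, Finsupp.sum_zero_index]

instance instFiniteWedge (t k : ℕ) : Module.Finite ℂ (Wedge t k) :=
  inferInstanceAs (Module.Finite ℂ (⋀[ℂ]^k (Vec t)))

instance instFiniteW (lam : YoungDiagram) (t : ℕ) : Module.Finite ℂ (W lam t) :=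
  inferInstanceAs (Module.Finite ℂ (ColTensor lam t ⧸ relations lam t))

/-- No nonzero vector is killed by all these forms, so their span is everything by duality in finite
dimension. This reduces identities for forms on `W` to explicit minors. -/
theorem span_highestForm_unitary (h : lam.colLen 0 ≤ t) :
    Submodule.span ℂ {f : Module.Dual ℂ (W lam t) | ∃ u ∈ Matrix.unitaryGroup (Fin t) ℂ,
      f = highestForm h ∘ₗ rho lam t u} = ⊤ := by
  set S := Submodule.span ℂ {f : Module.Dual ℂ (W lam t) | ∃ u ∈ Matrix.unitaryGroup (Fin t) ℂ,
      f = highestForm h ∘ₗ rho lam t u} with hS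
  have h0 : S.dualCoannihilator = ⊥ := by
    rw [eq_bot_iff]
    intro w hw
    rw [Submodule.mem_dualCoannihilator] at hw
    exact eq_zero_of_unitary h w fun u hu => hw _ (Submodule.subset_span ⟨u, hu, rfl⟩)
  rw [← Subspace.dualCoannihilator_dualAnnihilator_eq (W := S), h0,
    Submodule.dualAnnihilator_bot]

end Separation

/-! ### Left translations and the frame `ω` -/

/-- The `2t × 2t` orthogonal matrix is padded with an identity block. Multiplication by `ω = (1, i,
0)` then gives the blocks `P + iR`, `Q + iS` and `0`. -/
theorem exists_orthogonal_of_blocks {t n : ℕ} (hn : 2 * t ≤ n)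
    (P Q R S : Matrix (Fin t) (Fin t) ℝ)
    (h : Matrix.fromBlocks P Q R S * (Matrix.fromBlocks P Q R S)ᵀ = 1) :
    ∃ k : O n, ∀ (a : Fin t) (b : Fin n), (omega t n * (toOC n k).1) a b =
      if h1 : (b : ℕ) < t then (P a ⟨b, h1⟩ : ℂ) + Complex.I * R a ⟨b, h1⟩
      else if h2 : (b : ℕ) - t < t then (Q a ⟨b - t, h2⟩ : ℂ) + Complex.I * S a ⟨b - t, h2⟩
      else 0 := by
  obtain ⟨m, rfl⟩ : ∃ m, n = t + t + m := ⟨n - (t + t), by omega⟩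
  let e : (Fin t ⊕ Fin t) ⊕ Fin m ≃ Fin (t + t + m) :=
    (Equiv.sumCongr finSumFinEquiv (Equiv.refl _)).trans finSumFinEquiv
  let K : Matrix ((Fin t ⊕ Fin t) ⊕ Fin m) ((Fin t ⊕ Fin t) ⊕ Fin m) ℝ :=
    Matrix.fromBlocks (Matrix.fromBlocks P Q R S) 0 0 1
  have hK : K * Kᵀ = 1 := by
    simp only [K, Matrix.fromBlocks_transpose (Matrix.fromBlocks P Q R S),
      Matrix.fromBlocks_multiply (Matrix.fromBlocks P Q R S)]
    rw [h]
    simp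
  refine ⟨⟨K.submatrix e.symm e.symm, ?_⟩, fun a b => ?_⟩
  · rw [Matrix.mem_orthogonalGroup_iff, Matrix.transpose_submatrix,
      Matrix.submatrix_mul_equiv, hK, Matrix.submatrix_one_equiv]
  · obtain ⟨b, rfl⟩ := e.surjective b
    have hω1 : ∀ c, omega t (t + t + m) a (e (Sum.inl (Sum.inl c))) = if c = a then 1 else 0 := by
      intro c
      simp only [omega, e, Matrix.of_apply, Equiv.trans_apply, Equiv.sumCongr_apply, Sum.map_inl,
        finSumFinEquiv_apply_left, Fin.val_castAdd, Fin.ext_iff]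
      split_ifs <;> first | rfl | omega
    have hω2 : ∀ c, omega t (t + t + m) a (e (Sum.inl (Sum.inr c))) =
        if c = a then Complex.I else 0 := by
      intro c
      simp only [omega, e, Matrix.of_apply, Equiv.trans_apply, Equiv.sumCongr_apply, Sum.map_inl,
        finSumFinEquiv_apply_left, finSumFinEquiv_apply_right, Fin.val_castAdd, Fin.val_natAdd,
        Fin.ext_iff]
      split_ifs <;> first | rfl | omega
    have hω3 : ∀ c, omega t (t + t + m) a (e (Sum.inr c)) = 0 := by
      intro c
      simp only [omega, e, Matrix.of_apply, Equiv.trans_apply, Equiv.sumCongr_apply, Sum.map_inr,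
        finSumFinEquiv_apply_right, Fin.val_natAdd, Equiv.refl_apply]
      split_ifs <;> first | rfl | omega
    rw [Matrix.mul_apply, ← e.sum_comp]
    simp only [Fintype.sum_sum_type, hω1, hω2, hω3, toOC, MonoidHom.coe_mk, OneHom.coe_mk,
      Matrix.map_apply, Matrix.submatrix_apply, Equiv.symm_apply_apply, ite_mul, one_mul, zero_mul,
      Finset.sum_ite_eq', Finset.mem_univ, if_true, Finset.sum_const_zero, add_zero]
    rcases b with (b | b) | b
    · simp [K, e]
    · simp [K, e]
    · have h3 : ¬ t + t + (b : ℕ) < t := by omega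
      have h4 : ¬ t + t + (b : ℕ) - t < t := by omega
      simp [K, e, h3, h4]

/-- This is the embedding of `U(t)` in `O(2t)`: with `u = P + iR`, the block matrix with rows `(P,
-R)` and `(R, P)` sends `(1, i)` to `(u, iu)`. -/
theorem exists_omega_mul_eq_mul {t n : ℕ} (hn : 2 * t ≤ n) (u : Matrix (Fin t) (Fin t) ℂ)
    (hu : u ∈ Matrix.unitaryGroup (Fin t) ℂ) :
    ∃ k : O n, omega t n * (toOC n k).1 = u * omega t n := by
  have huu : u * uᴴ = 1 := Matrix.mem_unitaryGroup_iff.1 hu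
  let P : Matrix (Fin t) (Fin t) ℝ := u.map Complex.re
  let R : Matrix (Fin t) (Fin t) ℝ := u.map Complex.im
  have h1 : P * Pᵀ + R * Rᵀ = 1 := by
    ext i j
    have := congrArg Complex.re (congrFun (congrFun huu i) j)
    simp only [Matrix.mul_apply, Complex.re_sum, Matrix.conjTranspose_apply, Complex.mul_re,
      RCLike.star_def, Complex.conj_re, Complex.conj_im, Matrix.one_apply] at this
    simp only [Matrix.add_apply, Matrix.mul_apply, Matrix.transpose_apply, P, R, Matrix.map_apply,
      ← Finset.sum_add_distrib, Matrix.one_apply]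
    rw [apply_ite Complex.re, Complex.one_re, Complex.zero_re] at this
    rw [← this]
    exact Finset.sum_congr rfl fun _ _ => by ring
  have h2 : R * Pᵀ - P * Rᵀ = 0 := by
    ext i j
    have := congrArg Complex.im (congrFun (congrFun huu i) j)
    simp only [Matrix.mul_apply, Complex.im_sum, Matrix.conjTranspose_apply, Complex.mul_im,
      RCLike.star_def, Complex.conj_re, Complex.conj_im, Matrix.one_apply] at this
    simp only [Matrix.sub_apply, Matrix.mul_apply, Matrix.transpose_apply, P, R, Matrix.map_apply,
      ← Finset.sum_sub_distrib, Matrix.zero_apply]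
    rw [apply_ite Complex.im, Complex.one_im, Complex.zero_im, ite_self] at this
    rw [← this]
    exact Finset.sum_congr rfl fun _ _ => by ring
  obtain ⟨k, hk⟩ := exists_orthogonal_of_blocks hn P (-R) R P (by
    rw [Matrix.fromBlocks_transpose, Matrix.fromBlocks_multiply, ← Matrix.fromBlocks_one]
    congr 1
    · rw [← h1]; simp
    · have := congrArg Neg.neg h2
      simpa [add_comm, sub_eq_add_neg] using this
    · rw [← h2]; simp [sub_eq_add_neg]
    · rw [← h1]; simp [add_comm])
  refine ⟨k, ?_⟩
  ext a b
  rw [hk, Matrix.mul_apply]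
  split_ifs with hb1 hb2
  · rw [Finset.sum_eq_single ⟨b, hb1⟩]
    · simp [omega, P, R, mul_comm Complex.I, Complex.re_add_im]
    · intro c _ hc
      have h3 : ¬ (b : ℕ) = c := fun h => hc (Fin.ext h.symm)
      have h4 : ¬ (b : ℕ) = t + c := by omega
      simp [omega, h3, h4]
    · simp
  · rw [Finset.sum_eq_single ⟨b - t, hb2⟩]
    · have h3 : ¬ (b : ℕ) = b - t := by omega
      have h4 : (b : ℕ) = t + (b - t) := by omega
      simp only [omega, Matrix.of_apply, h3, if_false, ← h4, if_true, P, R, Matrix.neg_apply,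
        Matrix.map_apply]
      conv_rhs => rw [← Complex.re_add_im (u a _)]
      rw [add_mul, mul_assoc, Complex.I_mul_I]
      push_cast
      ring
    · intro c _ hc
      have h3 : ¬ (b : ℕ) = c := by omega
      have h4 : ¬ (b : ℕ) = t + c := fun h => hc (Fin.ext (by simp; omega))
      simp [omega, h3, h4]
    · simp
  · refine (Finset.sum_eq_zero fun c _ => ?_).symm
    have h3 : ¬ (b : ℕ) = c := by omega
    have h4 : ¬ (b : ℕ) = t + c := by omega
    simp [omega, h3, h4]

/-- Reversing the sign of the second block of `t` coordinates turns `(1, i, 0)` into `(1, -i, 0)`.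
-/
theorem exists_omega_mul_eq_conj {t n : ℕ} (hn : 2 * t ≤ n) :
    ∃ d : O n, omega t n * (toOC n d).1 = (omega t n).map (starRingEnd ℂ) := by
  obtain ⟨k, hk⟩ := exists_orthogonal_of_blocks hn (1 : Matrix (Fin t) (Fin t) ℝ) 0 0 (-1) (by
    rw [Matrix.fromBlocks_transpose, Matrix.fromBlocks_multiply, ← Matrix.fromBlocks_one]
    simp)
  refine ⟨k, ?_⟩
  ext a b
  rw [hk]
  simp only [omega, Matrix.map_apply, Matrix.of_apply, Matrix.one_apply, Matrix.zero_apply,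
    Matrix.neg_apply, Fin.ext_iff]
  split_ifs <;> simp <;> omega

/-! ### Weights -/

section Weights

variable {lam : YoungDiagram} {t : ℕ}

/-- The sum of the entries of a tableau. -/
def entrySum (T : Tableau lam t) : ℕ :=
  ∑ j : Fin (lam.rowLen 0), ∑ i : Fin (lam.colLen j), T.1 i j

/-- The sum of the row indices of the boxes of a diagram. -/
def rowSum (lam : YoungDiagram) : ℕ :=
  ∑ j : Fin (lam.rowLen 0), ∑ i : Fin (lam.colLen j), (i : ℕ)

/-- The tableau all of whose entries in row `i` are `i`. -/
def highestTableau (h : lam.colLen 0 ≤ t) : Tableau lam t :=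
  ⟨SemistandardYoungTableau.highestWeight lam, fun i j hij => by
    rw [SemistandardYoungTableau.highestWeight_apply, if_pos hij]
    exact (YoungDiagram.mem_iff_lt_colLen.1 hij).trans_le (colLen_le h j)⟩

theorem highestTableau_apply (h : lam.colLen 0 ≤ t) {i j : ℕ} (hi : i < lam.colLen j) :
    (highestTableau h).1 i j = i := by
  change SemistandardYoungTableau.highestWeight lam i j = i
  rw [SemistandardYoungTableau.highestWeight_apply,
    if_pos (YoungDiagram.mem_iff_lt_colLen.2 hi)]

theorem le_entry (T : Tableau lam t) {i j : ℕ} (hi : i < lam.colLen j) : i ≤ T.1 i j := by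
  induction i with
  | zero => exact Nat.zero_le _
  | succ i ih =>
    exact (ih (by omega)).trans_lt
      (T.1.col_strict (Nat.lt_succ_self i) (YoungDiagram.mem_iff_lt_colLen.2 hi))

/-- Every entry is at least its row index, so the least possible entry sum forces equality in each
box. For this reason the single integer `entrySum` suffices to isolate the highest weight. -/
theorem eq_highestTableau (h : lam.colLen 0 ≤ t) (T : Tableau lam t)
    (hT : entrySum T = rowSum lam) : T = highestTableau h := by
  have h1 : ∀ j ∈ (Finset.univ : Finset (Fin (lam.rowLen 0))),
      ∑ i : Fin (lam.colLen j), (i : ℕ) ≤ ∑ i : Fin (lam.colLen j), T.1 i j :=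
    fun j _ => Finset.sum_le_sum fun i _ => le_entry T i.2
  have h2 := (Finset.sum_eq_sum_iff_of_le h1).1 hT.symm
  refine Subtype.ext (SemistandardYoungTableau.ext fun i j => ?_)
  by_cases hij : (i, j) ∈ lam
  · have hi := YoungDiagram.mem_iff_lt_colLen.1 hij
    have hj := lt_rowLen_of_pos_colLen (Nat.zero_lt_of_lt hi)
    have h3 := (Finset.sum_eq_sum_iff_of_le fun i _ => le_entry T i.2).1
      (h2 ⟨j, hj⟩ (Finset.mem_univ _)) ⟨i, hi⟩ (Finset.mem_univ _)
    rw [highestTableau_apply h hi]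
    exact h3.symm
  · rw [T.1.zeros hij, (highestTableau h).1.zeros hij]

/-- The diagonal matrix with entries `ζ ^ i`. -/
def powDiagonal (t : ℕ) (ζ : ℂ) : Matrix (Fin t) (Fin t) ℂ :=
  Matrix.diagonal fun i => ζ ^ (i : ℕ)

theorem rho_powDiagonal_tabVec (ζ : ℂ) (T : Tableau lam t) :
    rho lam t (powDiagonal t ζ) (tabVec T) = ζ ^ entrySum T • tabVec T := by
  change rhoMap lam t _ (toW lam t _) = _
  rw [rhoMap_toW, rhoTensor_colElt, tabVec, ← map_smul]
  congr 1
  unfold colElt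
  have h1 : ζ ^ entrySum T = ∏ j : Fin (lam.rowLen 0), ζ ^ ∑ i : Fin (lam.colLen j), T.1 i j := by
    rw [entrySum, Finset.prod_pow_eq_pow_sum]
  rw [h1, ← MultilinearMap.map_smul_univ]
  congr 1
  funext j
  rw [← Finset.prod_pow_eq_pow_sum]
  refine Eq.trans ?_ ((exteriorPower.ιMulti ℂ (lam.colLen j)).toMultilinearMap.map_smul_univ _ _)
  unfold wedge
  change exteriorPower.ιMulti ℂ (lam.colLen j) _ = exteriorPower.ιMulti ℂ (lam.colLen j) _
  congr 1
  funext i k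
  simp only [powDiagonal, Matrix.mulVec_diagonal, Pi.smul_apply, smul_eq_mul]
  split_ifs with hk
  · rw [hk]
  · simp

/-- The minors involve the top rows only, and row `i` is scaled by `ζ ^ i`. Hence `highestForm` is
an eigenvector of the diagonal matrix, with the same eigenvalue as the highest weight vector. -/
theorem tabMinor_powDiagonal_mul (h : lam.colLen 0 ≤ t) (ζ : ℂ) (T : Tableau lam t)
    (M : Matrix (Fin t) (Fin t) ℂ) :
    tabMinor h T (powDiagonal t ζ * M) = ζ ^ rowSum lam * tabMinor h T M := by
  rw [rowSum, ← Finset.prod_pow_eq_pow_sum, tabMinor, tabMinor, ← Finset.prod_mul_distrib]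
  refine Finset.prod_congr rfl fun j _ => ?_
  rw [← Finset.prod_pow_eq_pow_sum, ← Matrix.det_mul_row]
  congr 1
  ext i i'
  simp [powDiagonal, Matrix.diagonal_mul]

theorem tabMinor_highestTableau (h : lam.colLen 0 ≤ t) (A : Matrix (Fin t) (Fin t) ℂ) :
    tabMinor h (highestTableau h) A = ∏ j : Fin (lam.rowLen 0),
      (Matrix.of fun i i' : Fin (lam.colLen j) =>
        A (Fin.castLE (colLen_le h j) i') (Fin.castLE (colLen_le h j) i)).det := by
  unfold tabMinor
  refine Finset.prod_congr rfl fun j _ => ?_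
  congr 1
  ext i i'
  simp only [Matrix.of_apply]
  congr 1
  exact Fin.ext (highestTableau_apply h i.2)

theorem tabMinor_highestTableau_one (h : lam.colLen 0 ≤ t) :
    tabMinor h (highestTableau h) 1 = 1 := by
  rw [tabMinor_highestTableau]
  refine Finset.prod_eq_one fun j _ => ?_
  rw [← Matrix.det_one (n := Fin (lam.colLen j))]
  congr 1
  ext i i'
  simp [Matrix.one_apply, Fin.ext_iff, eq_comm]

/-- For the highest tableau the minors are leading principal minors, which transposition preserves.
The Hermitian symmetry of `coeffForm` comes from here. -/
theorem tabMinor_highestTableau_conjTranspose (h : lam.colLen 0 ≤ t)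
    (A : Matrix (Fin t) (Fin t) ℂ) :
    tabMinor h (highestTableau h) Aᴴ = starRingEnd ℂ (tabMinor h (highestTableau h) A) := by
  rw [tabMinor_highestTableau, tabMinor_highestTableau, map_prod]
  refine Finset.prod_congr rfl fun j _ => ?_
  rw [RingHom.map_det, ← Matrix.det_transpose]
  rfl

theorem tabMinor_map_conj (h : lam.colLen 0 ≤ t) (T : Tableau lam t)
    (A : Matrix (Fin t) (Fin t) ℂ) :
    tabMinor h T (A.map (starRingEnd ℂ)) = starRingEnd ℂ (tabMinor h T A) := by
  unfold tabMinor
  rw [map_prod]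
  refine Finset.prod_congr rfl fun j _ => ?_
  rw [RingHom.map_det]
  rfl

theorem continuous_tabMinor (h : lam.colLen 0 ≤ t) (T : Tableau lam t) :
    Continuous (tabMinor h T) := by
  unfold tabMinor
  refine continuous_finsetProd _ fun j _ => Continuous.matrix_det ?_
  refine continuous_matrix fun i i' => ?_
  exact (continuous_apply_apply _ _)

end Weights

/-! ### Matrix coefficients -/

section Coefficients

variable {lam : YoungDiagram} {t n : ℕ}

theorem rho_mul_apply (A B : Matrix (Fin t) (Fin t) ℂ) (w : W lam t) :
    rho lam t (A * B) w = rho lam t A (rho lam t B w) := by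
  rw [map_mul, Module.End.mul_apply]

/-- The matrix `ω x ε`. -/
def frame (t : ℕ) {n : ℕ} (x : OC n) : Matrix (Fin t) (Fin t) ℂ :=
  omega t n * x.1 * eps n t

theorem phi_apply (w : W lam t) (x : OC n) : (phi lam t n w).1 x = rho lam t (frame t x) w := rfl

theorem piR_apply (y : O n) (f : V lam t n) (x : OC n) :
    (piR lam t n y f).1 x = f.1 (x * toOC n y) := rfl

theorem continuous_frame (y : O n) :
    Continuous fun x : O n => frame t (toOC n x * toOC n y) := by
  have h1 : Continuous fun x : O n => (toOC n x).1 := by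
    refine continuous_matrix fun i j => ?_
    exact Complex.continuous_ofReal.comp
      ((continuous_apply_apply i j).comp continuous_subtype_val)
  change Continuous fun x : O n => omega t n * ((toOC n x).1 * (toOC n y).1) * eps n t
  fun_prop

instance instIsHaarMeasureHaarO (n : ℕ) : (haarO n).IsHaarMeasure :=
  inferInstanceAs (MeasureTheory.Measure.haarMeasure ⊤).IsHaarMeasure

theorem integrable_of_continuous {f : O n → ℂ} (hf : Continuous f) :
    MeasureTheory.Integrable f (haarO n) :=
  hf.integrable_of_hasCompactSupport (HasCompactSupport.of_compactSpace f)

/-- It is enough to treat the spanning forms `highestForm ∘ ρ(u)`, for which the function is a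
product of minors of a continuous matrix function. -/
theorem continuous_dual_rho (h : lam.colLen 0 ≤ t) (f : Module.Dual ℂ (W lam t))
    (T : Tableau lam t) (y : O n) :
    Continuous fun x : O n => f (rho lam t (frame t (toOC n x * toOC n y)) (tabVec T)) := by
  have hf : f ∈ Submodule.span ℂ {f : Module.Dual ℂ (W lam t) |
      ∃ u ∈ Matrix.unitaryGroup (Fin t) ℂ, f = highestForm h ∘ₗ rho lam t u} :=
    span_highestForm_unitary h ▸ Submodule.mem_top
  induction hf using Submodule.span_induction with
  | mem f hf =>
    obtain ⟨u, -, rfl⟩ := hf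
    have : ∀ x : O n, (highestForm h ∘ₗ rho lam t u)
        (rho lam t (frame t (toOC n x * toOC n y)) (tabVec T)) =
        tabMinor h T (u * frame t (toOC n x * toOC n y)) := by
      intro x
      rw [← highestForm_rho_tabVec, rho_mul_apply, LinearMap.comp_apply]
    simp only [this]
    exact (continuous_tabMinor h T).comp (continuous_const.mul (continuous_frame y))
  | zero => exact continuous_const
  | add f g _ _ hf hg => exact hf.add hg
  | smul a f _ hf => exact continuous_const.mul hf

/-- The integral over `O(n)` of the product of the conjugate of a coordinate of `π(y₁) φ(e_(T₁))`
and a coordinate of `π(y₂) φ(e_(T₂))`. -/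
def coeffIntegral (T₁ T₂ : Tableau lam t) (y₁ y₂ : O n) (f g : Module.Dual ℂ (W lam t)) : ℂ :=
  ∫ x, starRingEnd ℂ (f (rho lam t (frame t (toOC n x * toOC n y₁)) (tabVec T₁))) *
    g (rho lam t (frame t (toOC n x * toOC n y₂)) (tabVec T₂)) ∂haarO n

variable (T₁ T₂ : Tableau lam t) (y₁ y₂ : O n)

theorem continuous_coeff (h : lam.colLen 0 ≤ t) (f g : Module.Dual ℂ (W lam t)) :
    Continuous fun x : O n =>
      starRingEnd ℂ (f (rho lam t (frame t (toOC n x * toOC n y₁)) (tabVec T₁))) *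
      g (rho lam t (frame t (toOC n x * toOC n y₂)) (tabVec T₂)) :=
  (Complex.continuous_conj.comp (continuous_dual_rho h f T₁ y₁)).mul
    (continuous_dual_rho h g T₂ y₂)

/-- `coeffIntegral` as a sesquilinear form. -/
def coeffForm (h : lam.colLen 0 ≤ t) :
    Module.Dual ℂ (W lam t) →ₗ⋆[ℂ] Module.Dual ℂ (W lam t) →ₗ[ℂ] ℂ :=
  LinearMap.mk₂'ₛₗ (starRingEnd ℂ) (RingHom.id ℂ) (coeffIntegral T₁ T₂ y₁ y₂)
    (fun f f' g => by
      simp only [coeffIntegral, LinearMap.add_apply, map_add, add_mul]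
      exact MeasureTheory.integral_add (integrable_of_continuous (continuous_coeff _ _ _ _ h f g))
        (integrable_of_continuous (continuous_coeff _ _ _ _ h f' g)))
    (fun a f g => by
      simp only [coeffIntegral, LinearMap.smul_apply, smul_eq_mul, map_mul, mul_assoc]
      exact MeasureTheory.integral_const_mul _ _)
    (fun f g g' => by
      simp only [coeffIntegral, LinearMap.add_apply, mul_add]
      exact MeasureTheory.integral_add (integrable_of_continuous (continuous_coeff _ _ _ _ h f g))
        (integrable_of_continuous (continuous_coeff _ _ _ _ h f g')))
    (fun a f g => by
      simp only [coeffIntegral, LinearMap.smul_apply, smul_eq_mul, RingHom.id_apply,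
        mul_left_comm _ a]
      exact MeasureTheory.integral_const_mul _ _)

theorem coeffForm_apply (h : lam.colLen 0 ≤ t) (f g : Module.Dual ℂ (W lam t)) :
    coeffForm T₁ T₂ y₁ y₂ h f g = coeffIntegral T₁ T₂ y₁ y₂ f g := rfl

/-! ### Invariance of the coefficient form under `U(t)` and its Hermitian symmetry -/

theorem frame_mul_left {k : O n} {u : Matrix (Fin t) (Fin t) ℂ}
    (hk : omega t n * (toOC n k).1 = u * omega t n) (x y : O n) :
    frame t (toOC n (k * x) * toOC n y) = u * frame t (toOC n x * toOC n y) := by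
  rw [map_mul, mul_assoc]
  change omega t n * ((toOC n k).1 * (toOC n x * toOC n y).1) * eps n t = _
  rw [← Matrix.mul_assoc (omega t n), hk, frame]
  simp only [Matrix.mul_assoc]

/-- Acting by `u` on the values is the same as translating `x` on the left by an element `k` of
`O(n)`, which Haar measure ignores. -/
theorem coeffIntegral_unitary (hn : 2 * t ≤ n) (u : Matrix (Fin t) (Fin t) ℂ)
    (hu : u ∈ Matrix.unitaryGroup (Fin t) ℂ) (f g : Module.Dual ℂ (W lam t)) :
    coeffIntegral T₁ T₂ y₁ y₂ (f ∘ₗ rho lam t u) (g ∘ₗ rho lam t u) =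
      coeffIntegral T₁ T₂ y₁ y₂ f g := by
  obtain ⟨k, hk⟩ := exists_omega_mul_eq_mul hn u hu
  unfold coeffIntegral
  conv_rhs => rw [← MeasureTheory.integral_mul_left_eq_self _ k]
  refine MeasureTheory.integral_congr_ae (Filter.Eventually.of_forall fun x => ?_)
  simp only [frame_mul_left hk]
  simp only [rho_mul_apply, LinearMap.comp_apply]

theorem mem_unitaryGroup_powDiagonal (t : ℕ) :
    powDiagonal t (Complex.exp Complex.I) ∈ Matrix.unitaryGroup (Fin t) ℂ :=
  diagonal_mem_unitaryGroup fun i => by rw [norm_pow, norm_exp_I, one_pow]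

/-- In the basis `e_T` the diagonal matrix acts by `ζ ^ entrySum T`; since the powers of `ζ` are
distinct, only tableaux with entry sum `rowSum lam` can occur, and there is just one. -/
theorem eq_smul_highest_of_weight (h : lam.colLen 0 ≤ t) (q : W lam t)
    (hq : rho lam t (powDiagonal t (Complex.exp Complex.I)) q =
      Complex.exp Complex.I ^ rowSum lam • q) :
    ∃ b : ℂ, q = b • tabVec (highestTableau h) := by
  obtain ⟨a, rfl⟩ := exists_eq_sum_tabVec q
  simp only [Finsupp.sum, map_sum, map_smul, rho_powDiagonal_tabVec, Finset.smul_sum] at hq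
  rw [← sub_eq_zero, ← Finset.sum_sub_distrib] at hq
  simp only [smul_smul, ← sub_smul] at hq
  have hli := linearIndependent_iff'.1 (linearIndependent_tabVec h) a.support _ hq
  refine ⟨a (highestTableau h), Finset.sum_eq_single _ (fun T hT hne => ?_) fun hT => ?_⟩
  · exfalso
    have h1 := hli T hT
    have h2 : a T ≠ 0 := Finsupp.mem_support_iff.1 hT
    rw [mul_comm, ← sub_mul] at h1
    have h3 := sub_eq_zero.1 ((mul_eq_zero.1 h1).resolve_right h2)
    exact hne (eq_highestTableau h T (exp_I_pow_injective h3))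
  · simp only [Finsupp.notMem_support_iff.1 hT, zero_smul]

/-- This takes the place of Schur's lemma: invariance under one torus element determines the
functional `coeffIntegral (highestForm h) ·` up to a scalar, without appeal to irreducibility. -/
theorem coeffIntegral_highestForm (h : lam.colLen 0 ≤ t) (hn : 2 * t ≤ n)
    (g : Module.Dual ℂ (W lam t)) :
    coeffIntegral T₁ T₂ y₁ y₂ (highestForm h) g =
      coeffIntegral T₁ T₂ y₁ y₂ (highestForm h) (highestForm h) * g (tabVec (highestTableau h)) := by
  -- A linear functional on the dual of the finite-dimensional space `W` is evaluation at a vector.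
  let q : W lam t := (Module.evalEquiv ℂ (W lam t)).symm (coeffForm T₁ T₂ y₁ y₂ h (highestForm h))
  have hq : ∀ g : Module.Dual ℂ (W lam t),
      coeffIntegral T₁ T₂ y₁ y₂ (highestForm h) g = g q := fun g =>
    ((Module.apply_evalEquiv_symm_apply ℂ (W lam t) g
      (coeffForm T₁ T₂ y₁ y₂ h (highestForm h))).trans (coeffForm_apply _ _ _ _ h _ g)).symm
  set ζ := Complex.exp Complex.I
  have hζ : starRingEnd ℂ ζ * ζ = 1 := by
    rw [mul_comm, Complex.mul_conj, Complex.normSq_eq_norm_sq, norm_exp_I]; simp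
  have hw : rho lam t (powDiagonal t ζ) q = ζ ^ rowSum lam • q := by
    rw [← sub_eq_zero, ← Module.forall_dual_apply_eq_zero_iff ℂ]
    intro g
    have h1 := coeffIntegral_unitary T₁ T₂ y₁ y₂ hn _ (mem_unitaryGroup_powDiagonal t)
      (highestForm h) g
    have h2 : coeffIntegral T₁ T₂ y₁ y₂ (highestForm h ∘ₗ rho lam t (powDiagonal t ζ))
        (g ∘ₗ rho lam t (powDiagonal t ζ)) = starRingEnd ℂ ζ ^ rowSum lam *
        coeffIntegral T₁ T₂ y₁ y₂ (highestForm h) (g ∘ₗ rho lam t (powDiagonal t ζ)) := by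
      unfold coeffIntegral
      rw [← MeasureTheory.integral_const_mul]
      refine MeasureTheory.integral_congr_ae (Filter.Eventually.of_forall fun x => ?_)
      -- The first argument is an eigenvector and contributes the conjugate of `ζ ^ rowSum lam`; as
      -- `|ζ| = 1`, invariance transfers the eigenvalue `ζ ^ rowSum lam` to `q`.
      have h3 : ∀ M : Matrix (Fin t) (Fin t) ℂ,
          (highestForm h ∘ₗ rho lam t (powDiagonal t ζ)) (rho lam t M (tabVec T₁)) =
          ζ ^ rowSum lam * highestForm h (rho lam t M (tabVec T₁)) := by
        intro M
        rw [highestForm_rho_tabVec, ← tabMinor_powDiagonal_mul, ← highestForm_rho_tabVec,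
          rho_mul_apply, LinearMap.comp_apply]
      simp only [h3, map_mul, map_pow, mul_assoc]
    rw [h2, hq, hq] at h1
    rw [map_sub, map_smul, ← h1, smul_eq_mul, ← mul_assoc, ← mul_pow, mul_comm ζ, hζ, one_pow,
      one_mul]
    exact sub_self _
  obtain ⟨b, hb⟩ := eq_smul_highest_of_weight h q hw
  have h1 : highestForm h (tabVec (highestTableau h)) = 1 := by
    have := highestForm_rho_tabVec h 1 (highestTableau h)
    rwa [map_one, tabMinor_highestTableau_one] at this
  rw [hq, hq, hb, map_smul, map_smul, h1, smul_eq_mul, smul_eq_mul, mul_one]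

/-- Applying `uᴴ` to both arguments turns the pair `(u, v)` into `(1, v uᴴ)`. -/
theorem coeffIntegral_highestForm_unitary (h : lam.colLen 0 ≤ t) (hn : 2 * t ≤ n)
    {u v : Matrix (Fin t) (Fin t) ℂ} (hu : u ∈ Matrix.unitaryGroup (Fin t) ℂ) :
    coeffIntegral T₁ T₂ y₁ y₂ (highestForm h ∘ₗ rho lam t u) (highestForm h ∘ₗ rho lam t v) =
      coeffIntegral T₁ T₂ y₁ y₂ (highestForm h) (highestForm h) *
        tabMinor h (highestTableau h) (v * uᴴ) := by
  rw [← coeffIntegral_unitary T₁ T₂ y₁ y₂ hn uᴴ (Unitary.star_mem hu)]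
  have h1 : ∀ A B : Matrix (Fin t) (Fin t) ℂ, (highestForm h ∘ₗ rho lam t A) ∘ₗ rho lam t B =
      highestForm h ∘ₗ rho lam t (A * B) := by
    intro A B
    refine LinearMap.ext fun w => ?_
    simp only [LinearMap.comp_apply, rho_mul_apply]
  have h2 : u * uᴴ = 1 := Matrix.mem_unitaryGroup_iff.1 hu
  have h3 : highestForm h ∘ₗ rho lam t 1 = highestForm h := by
    refine LinearMap.ext fun w => ?_
    rw [LinearMap.comp_apply, map_one, Module.End.one_apply]
  rw [h1, h1, h2, h3, coeffIntegral_highestForm T₁ T₂ y₁ y₂ h hn, ← highestForm_rho_tabVec,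
    LinearMap.comp_apply]

/-- Complex conjugation on `O(n, ℂ)`. -/
def conjOC (n : ℕ) : OC n →* OC n where
  toFun x := ⟨x.1.map (starRingEnd ℂ), by
    have h := (Matrix.mem_orthogonalGroup_iff _ _).1 x.2
    rw [Matrix.mem_orthogonalGroup_iff, ← Matrix.transpose_map, ← Matrix.map_mul, h]
    exact Matrix.map_one _ (map_zero _) (map_one _)⟩
  map_one' := Subtype.ext (Matrix.map_one _ (map_zero _) (map_one _))
  map_mul' x y := Subtype.ext (Matrix.map_mul (f := starRingEnd ℂ))

theorem conjOC_toOC (x : O n) : conjOC n (toOC n x) = toOC n x := by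
  refine Subtype.ext (Matrix.ext fun i j => ?_)
  exact Complex.conj_ofReal _

theorem frame_conjOC {d : O n} (hd : omega t n * (toOC n d).1 = (omega t n).map (starRingEnd ℂ))
    (x : OC n) : frame t (toOC n d * conjOC n x) = (frame t x).map (starRingEnd ℂ) := by
  have heps : (eps n t).map (starRingEnd ℂ) = eps n t := by
    ext i j
    simp [eps, apply_ite]
  change omega t n * ((toOC n d).1 * x.1.map (starRingEnd ℂ)) * eps n t = _
  rw [← Matrix.mul_assoc (omega t n), hd, frame, Matrix.map_mul, Matrix.map_mul, heps]

theorem frame_conj_left {d : O n} (hd : omega t n * (toOC n d).1 = (omega t n).map (starRingEnd ℂ))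
    (x y : O n) : frame t (toOC n (d * x) * toOC n y) =
      (frame t (toOC n x * toOC n y)).map (starRingEnd ℂ) := by
  rw [← frame_conjOC hd, map_mul, map_mul, conjOC_toOC, conjOC_toOC, mul_assoc]

/-- Translation by `d` conjugates the matrix `ω x ε`, and the minors have real coefficients, so the
substitution `x ↦ d x` conjugates the integrand. -/
theorem conj_coeffIntegral_highestForm (h : lam.colLen 0 ≤ t) (hn : 2 * t ≤ n) :
    starRingEnd ℂ (coeffIntegral T₁ T₂ y₁ y₂ (highestForm h) (highestForm h)) =
      coeffIntegral T₁ T₂ y₁ y₂ (highestForm h) (highestForm h) := by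
  obtain ⟨d, hd⟩ := exists_omega_mul_eq_conj hn
  unfold coeffIntegral
  conv_rhs => rw [← MeasureTheory.integral_mul_left_eq_self _ d]
  rw [← integral_conj]
  refine MeasureTheory.integral_congr_ae (Filter.Eventually.of_forall fun x => ?_)
  simp only [frame_conj_left hd]
  simp only [highestForm_rho_tabVec, tabMinor_map_conj, map_mul]

/-- On the spanning forms, the value is a real constant times leading principal minors of `v uᴴ`;
interchanging `u` and `v` replaces this matrix by its conjugate transpose. Sesquilinearity does the
rest. -/
theorem conj_coeffForm (h : lam.colLen 0 ≤ t) (hn : 2 * t ≤ n) (f g : Module.Dual ℂ (W lam t)) :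
    starRingEnd ℂ (coeffForm T₁ T₂ y₁ y₂ h f g) = coeffForm T₁ T₂ y₁ y₂ h g f := by
  have hmem : ∀ f : Module.Dual ℂ (W lam t),
      f ∈ Submodule.span ℂ {f : Module.Dual ℂ (W lam t) |
        ∃ u ∈ Matrix.unitaryGroup (Fin t) ℂ, f = highestForm h ∘ₗ rho lam t u} :=
    fun f => span_highestForm_unitary h ▸ Submodule.mem_top
  induction hmem f using Submodule.span_induction with
  | mem f hf =>
    obtain ⟨u, hu, rfl⟩ := hf
    induction hmem g using Submodule.span_induction with
    | mem g hg =>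
      obtain ⟨v, hv, rfl⟩ := hg
      rw [coeffForm_apply, coeffForm_apply, coeffIntegral_highestForm_unitary _ _ _ _ h hn hu,
        coeffIntegral_highestForm_unitary _ _ _ _ h hn hv, map_mul,
        conj_coeffIntegral_highestForm _ _ _ _ h hn, ← tabMinor_highestTableau_conjTranspose,
        Matrix.conjTranspose_mul, Matrix.conjTranspose_conjTranspose]
    | zero => simp
    | add g g' _ _ hg hg' => simp only [map_add, LinearMap.add_apply, hg, hg']
    | smul a g _ hg => simp [hg]
  | zero => simp
  | add f f' _ _ hf hf' => simp only [map_add, LinearMap.add_apply, hf, hf']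
  | smul a f _ hf => simp [hf]

end Coefficients

/-! ### Reality of the inner products -/

section Inner

variable {lam : YoungDiagram} {t n : ℕ} (c : InnerProductSpace.Core ℂ (W lam t))

theorem core_conj_symm (v w : W lam t) : starRingEnd ℂ (c.inner w v) = c.inner v w :=
  c.conj_inner_symm v w

theorem core_add_right (u v w : W lam t) : c.inner u (v + w) = c.inner u v + c.inner u w := by
  rw [← core_conj_symm, c.add_left, map_add, core_conj_symm, core_conj_symm]

theorem core_smul_right (a : ℂ) (u v : W lam t) : c.inner u (a • v) = a * c.inner u v := by
  rw [← core_conj_symm, c.smul_left, map_mul, core_conj_symm, Complex.conj_conj]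

/-- An inner product on `W` as a sesquilinear map. -/
def coreForm : W lam t →ₗ⋆[ℂ] W lam t →ₗ[ℂ] ℂ :=
  LinearMap.mk₂'ₛₗ (starRingEnd ℂ) (RingHom.id ℂ) c.inner c.add_left
    (fun a v w => c.smul_left v w a) (core_add_right c) (core_smul_right c)

theorem coreForm_apply (v w : W lam t) : coreForm c v w = c.inner v w := rfl

theorem core_eq_sum {ι : Type*} [Fintype ι] (b : Module.Basis ι ℂ (W lam t)) (v w : W lam t) :
    c.inner v w = ∑ k, ∑ l, c.inner (b k) (b l) *
      (starRingEnd ℂ (b.coord k v) * b.coord l w) := by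
  rw [← coreForm_apply]
  conv_lhs => rw [← b.sum_repr v, ← b.sum_repr w]
  simp only [map_sum, LinearMap.sum_apply, map_smul, map_smulₛₗ, LinearMap.smul_apply,
    smul_eq_mul, coreForm_apply, Module.Basis.coord_apply]
  rw [Finset.sum_comm]
  refine Finset.sum_congr rfl fun k _ => ?_
  rw [Finset.mul_sum]
  refine Finset.sum_congr rfl fun l _ => ?_
  ring

theorem integrand_tabVec {ι : Type*} [Fintype ι] (b : Module.Basis ι ℂ (W lam t))
    (T₁ T₂ : Tableau lam t) (y₁ y₂ : O n) (x : O n) :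
    integrand c (piR lam t n y₁ (phi lam t n (tabVec T₁)))
      (piR lam t n y₂ (phi lam t n (tabVec T₂))) x =
    ∑ k, ∑ l, c.inner (b k) (b l) *
      (starRingEnd ℂ (b.coord k (rho lam t (frame t (toOC n x * toOC n y₁)) (tabVec T₁))) *
        b.coord l (rho lam t (frame t (toOC n x * toOC n y₂)) (tabVec T₂))) := by
  rw [← core_eq_sum]
  rfl

theorem integrable_integrand_tabVec (h : lam.colLen 0 ≤ t) (T₁ T₂ : Tableau lam t)
    (y₁ y₂ : O n) :
    MeasureTheory.Integrable (integrand c (piR lam t n y₁ (phi lam t n (tabVec T₁)))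
      (piR lam t n y₂ (phi lam t n (tabVec T₂)))) (haarO n) := by
  refine integrable_of_continuous (Continuous.congr ?_ fun x =>
    (integrand_tabVec c (Module.finBasis ℂ (W lam t)) T₁ T₂ y₁ y₂ x).symm)
  exact continuous_finsetSum _ fun k _ => continuous_finsetSum _ fun l _ =>
    continuous_const.mul (continuous_coeff T₁ T₂ y₁ y₂ h _ _)

/-- In a basis of `W` the inner product is a double sum of products of entries of two Hermitian
matrices, and conjugation merely interchanges the summation indices. The inner product on `W` need
not be `U(t)`-invariant. -/
theorem im_innerV_tabVec (h : lam.colLen 0 ≤ t) (hn : 2 * t ≤ n) (T₁ T₂ : Tableau lam t)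
    (y₁ y₂ : O n) :
    (innerV c (piR lam t n y₁ (phi lam t n (tabVec T₁)))
      (piR lam t n y₂ (phi lam t n (tabVec T₂)))).im = 0 := by
  let b := Module.finBasis ℂ (W lam t)
  have hsum : innerV c (piR lam t n y₁ (phi lam t n (tabVec T₁)))
      (piR lam t n y₂ (phi lam t n (tabVec T₂))) =
      ∑ k, ∑ l, c.inner (b k) (b l) * coeffForm T₁ T₂ y₁ y₂ h (b.coord k) (b.coord l) := by
    unfold innerV
    simp only [integrand_tabVec c b]
    have hint : ∀ k l, MeasureTheory.Integrable (fun x : O n => c.inner (b k) (b l) *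
        (starRingEnd ℂ (b.coord k (rho lam t (frame t (toOC n x * toOC n y₁)) (tabVec T₁))) *
        b.coord l (rho lam t (frame t (toOC n x * toOC n y₂)) (tabVec T₂)))) (haarO n) :=
      fun k l => (integrable_of_continuous (continuous_coeff T₁ T₂ y₁ y₂ h _ _)).const_mul _
    rw [MeasureTheory.integral_finsetSum _ fun k _ =>
      MeasureTheory.integrable_finsetSum _ fun l _ => hint k l]
    refine Finset.sum_congr rfl fun k _ => ?_
    rw [MeasureTheory.integral_finsetSum _ fun l _ => hint k l]
    exact Finset.sum_congr rfl fun l _ => MeasureTheory.integral_const_mul _ _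
  rw [← Complex.conj_eq_iff_im, hsum]
  simp only [map_sum, map_mul, core_conj_symm, conj_coeffForm _ _ _ _ h hn]
  exact Finset.sum_comm

theorem conj_innerV (f g : V lam t n) : starRingEnd ℂ (innerV c f g) = innerV c g f := by
  unfold innerV
  rw [← integral_conj]
  exact MeasureTheory.integral_congr_ae
    (Filter.Eventually.of_forall fun x => core_conj_symm c _ _)

/-- The inner product of two functions converges and is real. -/
def IsRealPair (f g : V lam t n) : Prop :=
  MeasureTheory.Integrable (integrand c f g) (haarO n) ∧ (innerV c f g).im = 0

variable {c}

theorem IsRealPair.symm {f g : V lam t n} (h : IsRealPair c f g) : IsRealPair c g f := by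
  refine ⟨?_, ?_⟩
  · exact ((Complex.conjCLE : ℂ →L[ℝ] ℂ).integrable_comp h.1).congr (Filter.Eventually.of_forall fun x => core_conj_symm c _ _)
  · rw [← conj_innerV, Complex.conj_im, h.2, neg_zero]

theorem IsRealPair.add_right {f g g' : V lam t n} (h : IsRealPair c f g)
    (h' : IsRealPair c f g') : IsRealPair c f (g + g') := by
  have heq : integrand c f (g + g') = fun x => integrand c f g x + integrand c f g' x := by
    funext x
    exact core_add_right c _ _ _
  refine ⟨heq ▸ h.1.add h'.1, ?_⟩
  rw [innerV, heq, MeasureTheory.integral_add h.1 h'.1, Complex.add_im]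
  exact (congrArg₂ (· + ·) h.2 h'.2).trans (add_zero 0)

theorem IsRealPair.smul_right {f g : V lam t n} (a : ℝ) (h : IsRealPair c f g) :
    IsRealPair c f ((a : ℂ) • g) := by
  have heq : integrand c f ((a : ℂ) • g) = fun x => (a : ℂ) * integrand c f g x := by
    funext x
    exact core_smul_right c _ _ _
  refine ⟨heq ▸ h.1.const_mul _, ?_⟩
  rw [innerV, heq, MeasureTheory.integral_const_mul, Complex.im_ofReal_mul]
  exact (congrArg (a * ·) h.2).trans (mul_zero a)

theorem isRealPair_zero_right (f : V lam t n) : IsRealPair c f 0 := by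
  have heq : integrand c f 0 = fun _ => 0 := by
    funext x
    have := core_smul_right c 0 (f.1 (toOC n x)) 0
    rwa [zero_mul, zero_smul] at this
  refine ⟨heq ▸ MeasureTheory.integrable_zero _ _ _, ?_⟩
  rw [innerV, heq, MeasureTheory.integral_zero, Complex.zero_im]

theorem isRealPair_of_mem_realSpan (h : lam.colLen 0 ≤ t) (hn : 2 * t ≤ n) (y₁ y₂ : O n)
    {f g : V lam t n} (hf : f ∈ realSpan lam t n) (hg : g ∈ realSpan lam t n) :
    IsRealPair c (piR lam t n y₁ f) (piR lam t n y₂ g) := by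
  induction hg using Submodule.span_induction with
  | mem g hg =>
    obtain ⟨T₂, rfl⟩ := hg
    induction hf using Submodule.span_induction with
    | mem f hf =>
      obtain ⟨T₁, rfl⟩ := hf
      exact ⟨integrable_integrand_tabVec c h T₁ T₂ y₁ y₂, im_innerV_tabVec c h hn T₁ T₂ y₁ y₂⟩
    | zero => rw [map_zero]; exact (isRealPair_zero_right _).symm
    | add f f' _ _ hf hf' => rw [map_add]; exact (hf.symm.add_right hf'.symm).symm
    | smul a f _ hf =>
      rw [← Complex.coe_smul, map_smul]; exact (hf.symm.smul_right a).symm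
  | zero => rw [map_zero]; exact isRealPair_zero_right _
  | add g g' _ _ hg hg' => rw [map_add]; exact hg.add_right hg'
  | smul a g _ hg => rw [← Complex.coe_smul, map_smul]; exact hg.smul_right a

end Inner

/-! ### Real structure on the invariants -/

section Invariants

variable {lam : YoungDiagram} {t n : ℕ}

theorem highestForm_rho_conj (h : lam.colLen 0 ≤ t) (a : Tableau lam t →₀ ℂ)
    (A : Matrix (Fin t) (Fin t) ℂ) :
    highestForm h (rho lam t A (∑ T ∈ a.support, starRingEnd ℂ (a T) • tabVec T)) =
      starRingEnd ℂ (highestForm h (rho lam t (A.map (starRingEnd ℂ))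
        (∑ T ∈ a.support, a T • tabVec T))) := by
  simp only [map_sum, map_smul, highestForm_rho_tabVec, smul_eq_mul, map_mul, tabMinor_map_conj,
    Complex.conj_conj]

/-- Tested against `highestForm ∘ ρ(u)`, the value at `x` of `φ` of the conjugated vector is the
conjugate of a form applied to the value of the original function at `d x̄`. As `g` is real, `x g`
becomes `d x̄ g`, and invariance can be used at the point `d x̄`. -/
theorem phi_conj_mem_invariants (h : lam.colLen 0 ≤ t) (hn : 2 * t ≤ n) (H : Subgroup (O n))
    (a : Tableau lam t →₀ ℂ)
    (ha : phi lam t n (∑ T ∈ a.support, a T • tabVec T) ∈ invariants lam t H) :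
    phi lam t n (∑ T ∈ a.support, starRingEnd ℂ (a T) • tabVec T) ∈ invariants lam t H := by
  obtain ⟨d, hd⟩ := exists_omega_mul_eq_conj hn
  intro g hg
  refine Subtype.ext (funext fun x => ?_)
  rw [piR_apply, phi_apply, phi_apply, ← sub_eq_zero]
  refine eq_zero_of_unitary h _ fun u _ => ?_
  rw [map_sub, map_sub, ← rho_mul_apply, ← rho_mul_apply, highestForm_rho_conj,
    highestForm_rho_conj, Matrix.map_mul, Matrix.map_mul, ← frame_conjOC hd, ← frame_conjOC hd,
    rho_mul_apply, rho_mul_apply, map_mul (conjOC n), conjOC_toOC, ← mul_assoc]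
  have := congrFun (congrArg Subtype.val (ha g hg)) (toOC n d * conjOC n x)
  rw [piR_apply, phi_apply, phi_apply] at this
  rw [this, sub_self]

theorem phi_real_mem_realSpan (s : Finset (Tableau lam t)) (a : Tableau lam t → ℝ) :
    phi lam t n (∑ T ∈ s, (a T : ℂ) • tabVec T) ∈ realSpan lam t n := by
  rw [map_sum]
  refine Submodule.sum_mem _ fun T _ => ?_
  have hT := Submodule.smul_mem (realSpan lam t n) (a T) (Submodule.subset_span ⟨T, rfl⟩)
  rwa [← Complex.coe_smul, ← map_smul] at hT

/-- Conjugation of the coefficients preserves the invariants, so an invariant `φ(w)` splits as `v₁ +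
i v₂` with invariant `v₁` and `v₂` that have the real and imaginary parts of the coefficients. -/
theorem span_real_invariants (h : lam.colLen 0 ≤ t) (hn : 2 * t ≤ n) (H : Subgroup (O n)) :
    Submodule.span ℂ {v | v ∈ invariants lam t H ∧ v ∈ realSpan lam t n} =
      invariants lam t H ⊓ LinearMap.range (phi lam t n) := by
  refine le_antisymm (Submodule.span_le.2 ?_) ?_
  · rintro v ⟨hv, hr⟩
    refine ⟨hv, ?_⟩
    have hle : realSpan lam t n ≤ (LinearMap.range (phi lam t n)).restrictScalars ℝ := by
      refine Submodule.span_le.2 ?_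
      rintro _ ⟨T, rfl⟩
      exact ⟨_, rfl⟩
    exact hle hr
  · rintro _ ⟨hv, w, rfl⟩
    obtain ⟨a, rfl⟩ := exists_eq_sum_tabVec w
    rw [Finsupp.sum] at hv ⊢
    have hc := phi_conj_mem_invariants h hn H a hv
    set v := phi lam t n (∑ T ∈ a.support, a T • tabVec T)
    set v' := phi lam t n (∑ T ∈ a.support, starRingEnd ℂ (a T) • tabVec T)
    have hre : phi lam t n (∑ T ∈ a.support, ((a T).re : ℂ) • tabVec T) =
        (2⁻¹ : ℂ) • (v + v') := by
      rw [← map_add, ← map_smul, ← Finset.sum_add_distrib, Finset.smul_sum]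
      congr 1
      refine Finset.sum_congr rfl fun T _ => ?_
      rw [← add_smul, Complex.add_conj, smul_smul]
      congr 1
      push_cast
      ring
    have him : phi lam t n (∑ T ∈ a.support, ((a T).im : ℂ) • tabVec T) =
        (2⁻¹ * -Complex.I) • (v - v') := by
      rw [← map_sub, ← map_smul, ← Finset.sum_sub_distrib, Finset.smul_sum]
      congr 1
      refine Finset.sum_congr rfl fun T _ => ?_
      rw [← sub_smul, Complex.sub_conj, smul_smul]
      congr 1
      push_cast
      linear_combination ((a T).im : ℂ) * Complex.I_mul_I
    have hv1 := phi_real_mem_realSpan (n := n) a.support fun T => (a T).re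
    have hv2 := phi_real_mem_realSpan (n := n) a.support fun T => (a T).im
    rw [hre] at hv1
    rw [him] at hv2
    have heq : v = (2⁻¹ : ℂ) • (v + v') + Complex.I • (2⁻¹ * -Complex.I) • (v - v') := by
      rw [smul_smul]
      have : Complex.I * (2⁻¹ * -Complex.I) = 2⁻¹ := by
        linear_combination (-2⁻¹ : ℂ) * Complex.I_mul_I
      rw [this]
      module
    rw [heq]
    refine Submodule.add_mem _ (Submodule.subset_span ⟨?_, hv1⟩)
      (Submodule.smul_mem _ _ (Submodule.subset_span ⟨?_, hv2⟩))
    · exact Submodule.smul_mem _ _ (Submodule.add_mem _ hv hc)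
    · exact Submodule.smul_mem _ _ (Submodule.sub_mem _ hv hc)

end Invariants

/-! ### Restriction of the semidefinite program to real matrices -/

/-- For a Hermitian matrix the entrywise real part is the average of the matrix and its transpose,
and both are positive semidefinite. -/
theorem posSemidef_map_re {ι : Type*} [Fintype ι] {F : Matrix ι ι ℂ} (hF : F.PosSemidef) :
    ((F.map Complex.re).map Complex.ofReal).PosSemidef := by
  have h : (F.map Complex.re).map Complex.ofReal = (2⁻¹ : ℝ) • (F + Fᵀ) := by
    ext i j
    have h1 : F j i = starRingEnd ℂ (F i j) := (hF.1.apply j i).symm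
    simp only [Matrix.map_apply, Matrix.smul_apply, Matrix.add_apply, Matrix.transpose_apply, h1,
      Complex.add_conj, Complex.real_smul]
    push_cast
    ring
  rw [h]
  exact (hF.add hF.transpose).smul (by norm_num)

theorem posSemidef_of_map_ofReal {ι : Type*} [Fintype ι] {M : Matrix ι ι ℝ}
    (hM : (M.map Complex.ofReal).PosSemidef) : M.PosSemidef := by
  refine Matrix.PosSemidef.of_dotProduct_mulVec_nonneg ?_ fun x => ?_
  · ext i j
    have := hM.1.apply i j
    simpa using this
  · have := hM.dotProduct_mulVec_nonneg fun i => (x i : ℂ)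
    have h2 : star (fun i => (x i : ℂ)) ⬝ᵥ (M.map Complex.ofReal) *ᵥ (fun i => (x i : ℂ)) =
        ((star x ⬝ᵥ M *ᵥ x : ℝ) : ℂ) := by
      simp [dotProduct, Matrix.mulVec]
    rw [h2] at this
    exact_mod_cast this

section Program

variable {n t N : ℕ} {D : Finset ℝ} (orb : OrbitChoice n t D N) {Lam : Finset YoungDiagram}
  (c : ∀ l : Lam, InnerProductSpace.Core ℂ (W l.1 t)) {d : Lam → Fin N → ℕ}
  (e : ∀ l i, Module.Basis (Fin (d l i)) ℂ (invariants (n := n) l.1 t (stab (orb.R i))))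

/-- The kernel is linear in `F`, and the coefficients are real because the bases consist of real
combinations of the `φ(e_T)`. -/
theorem kernel_map_re (hn : 2 * t ≤ n) (hLam : ∀ lam ∈ Lam, lam.colLen 0 ≤ t)
    (he : ∀ l i j, (e l i j : V l.1 t n) ∈ realSpan l.1 t n)
    (F : ∀ l : Lam, Matrix (Σ i, Fin (d l i)) (Σ i, Fin (d l i)) ℂ)
    (J₁ J₂ : Finset (Fin n → ℝ)) :
    kernel orb c e (fun l => ((F l).map Complex.re).map Complex.ofReal) J₁ J₂ =
      ((kernel orb c e F J₁ J₂).re : ℂ) := by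
  unfold kernel
  simp only [Complex.re_sum, Complex.ofReal_sum]
  refine Finset.sum_congr rfl fun l _ => Finset.sum_congr rfl fun j₁ _ =>
    Finset.sum_congr rfl fun j₂ _ => ?_
  have h := (isRealPair_of_mem_realSpan (c := c l) (hLam l.1 l.2) hn (orb.s J₁) (orb.s J₂)
    (he l (orb.idx J₁) j₁) (he l (orb.idx J₂) j₂)).2
  obtain ⟨r, hr⟩ : ∃ r : ℝ, innerV (c l) (piR l.1 t n (orb.s J₁) (e l (orb.idx J₁) j₁))
      (piR l.1 t n (orb.s J₂) (e l (orb.idx J₂) j₂)) = r := ⟨_, (Complex.conj_eq_iff_re.1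
        (Complex.conj_eq_iff_im.2 h)).symm⟩
  rw [hr, Complex.re_mul_ofReal, Complex.ofReal_mul]
  rfl

/-- On the diagonal this shows that the kernel is real; in particular the objective value is
unchanged by taking real parts. -/
theorem conj_kernel {F : ∀ l : Lam, Matrix (Σ i, Fin (d l i)) (Σ i, Fin (d l i)) ℂ}
    (hF : ∀ l, (F l).IsHermitian) (J₁ J₂ : Finset (Fin n → ℝ)) :
    starRingEnd ℂ (kernel orb c e F J₁ J₂) = kernel orb c e F J₂ J₁ := by
  unfold kernel
  simp only [map_sum, map_mul, conj_innerV]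
  refine Finset.sum_congr rfl fun l _ => ?_
  rw [Finset.sum_comm]
  refine Finset.sum_congr rfl fun j₁ _ => Finset.sum_congr rfl fun j₂ _ => ?_
  congr 1
  exact (hF l).apply _ _

theorem opA_ofReal_re (K : Finset (Fin n → ℝ) → Finset (Fin n → ℝ) → ℂ)
    (S : Finset (Fin n → ℝ)) :
    opA t (fun J₁ J₂ => ((K J₁ J₂).re : ℂ)) S = ((opA t K S).re : ℂ) := by
  simp only [opA, Complex.re_sum, Complex.ofReal_sum]

theorem isFeasible_map_re (hn : 2 * t ≤ n) (hLam : ∀ lam ∈ Lam, lam.colLen 0 ≤ t)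
    (he : ∀ l i j, (e l i j : V l.1 t n) ∈ realSpan l.1 t n) {S : Set (Finset (Fin n → ℝ))}
    {F : ∀ l : Lam, Matrix (Σ i, Fin (d l i)) (Σ i, Fin (d l i)) ℂ}
    (hF : IsFeasible orb S c e F) :
    IsFeasible orb S c e fun l => ((F l).map Complex.re).map Complex.ofReal := by
  refine ⟨fun l => posSemidef_map_re (hF.posSemidef l), fun Q hQ => ?_⟩
  have hK : kernel orb c e (fun l => ((F l).map Complex.re).map Complex.ofReal) =
      fun J₁ J₂ => ((kernel orb c e F J₁ J₂).re : ℂ) :=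
    funext fun J₁ => funext fun J₂ => kernel_map_re orb c e hn hLam he F J₁ J₂
  rw [hK, opA_ofReal_re]
  have h := hF.constraint Q hQ
  -- The order on `ℂ` already forces `A_t K(Q)` to be real, so passing to its real part changes
  -- nothing.
  refine le_trans (le_of_eq ?_) h
  refine Complex.ext (Complex.ofReal_re _) ?_
  rw [Complex.ofReal_im, (Complex.le_def.1 h).2]
  split_ifs <;> simp

end Program

end GrossKunze

end

/-! ### The three statements assembled -/

theorem proposition3p2 (n t : ℕ) (hn : 2 * t < n) :
    -- the matrix coefficients are real, for every inner product on `W`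
    (∀ (lam : YoungDiagram), lam.colLen 0 ≤ t →
      ∀ (c : InnerProductSpace.Core ℂ (GrossKunze.W lam t))
        (T₁ T₂ : GrossKunze.Tableau lam t) (y : GrossKunze.O n),
        MeasureTheory.Integrable
          (GrossKunze.integrand c (GrossKunze.phi lam t n (GrossKunze.tabVec T₁))
            (GrossKunze.piR lam t n y (GrossKunze.phi lam t n (GrossKunze.tabVec T₂))))
          (GrossKunze.haarO n) ∧
        (GrossKunze.innerV c (GrossKunze.phi lam t n (GrossKunze.tabVec T₁))
          (GrossKunze.piR lam t n y (GrossKunze.phi lam t n (GrossKunze.tabVec T₂)))).im = 0) ∧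
    -- the invariants in `φ(W)` of a subgroup are spanned by those with real coordinates
    (∀ (lam : YoungDiagram), lam.colLen 0 ≤ t → ∀ H : Subgroup (GrossKunze.O n),
      Submodule.span ℂ {v | v ∈ GrossKunze.invariants lam t H ∧ v ∈ GrossKunze.realSpan lam t n} =
        GrossKunze.invariants lam t H ⊓ LinearMap.range (GrossKunze.phi lam t n)) ∧
    -- the semidefinite program can be restricted to real matrices
    (∀ (D : Finset ℝ), (∀ a ∈ D, -1 ≤ a ∧ a < 1) →
      ∀ (N : ℕ) (orb : GrossKunze.OrbitChoice n t D N)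
        (S : Set (Finset (Fin n → ℝ))), GrossKunze.IsConstraintSet n t D S →
      ∀ (Lam : Finset YoungDiagram), (∀ lam ∈ Lam, lam.colLen 0 ≤ t) →
      ∀ (c : ∀ l : Lam, InnerProductSpace.Core ℂ (GrossKunze.W l.1 t)) (d : Lam → Fin N → ℕ)
        (e : ∀ l i, Module.Basis (Fin (d l i)) ℂ
          (GrossKunze.invariants (n := n) l.1 t (GrossKunze.stab (orb.R i)))),
        (∀ l i j, (e l i j : GrossKunze.V l.1 t n) ∈ GrossKunze.realSpan l.1 t n) →
      ∀ F : ∀ l : Lam, Matrix (Σ i, Fin (d l i)) (Σ i, Fin (d l i)) ℂ,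
        GrossKunze.IsFeasible orb S c e F →
        ∃ F' : ∀ l : Lam, Matrix (Σ i, Fin (d l i)) (Σ i, Fin (d l i)) ℝ,
          (∀ l, (F' l).PosSemidef) ∧
          GrossKunze.IsFeasible orb S c e (fun l => (F' l).map Complex.ofReal) ∧
          GrossKunze.kernel orb c e (fun l => (F' l).map Complex.ofReal) ∅ ∅ =
            GrossKunze.kernel orb c e F ∅ ∅ ∧
          ∀ J₁ ∈ GrossKunze.indep n t D, ∀ J₂ ∈ GrossKunze.indep n t D,
            GrossKunze.kernel orb c e (fun l => (F' l).map Complex.ofReal) J₁ J₂ =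
              ((GrossKunze.kernel orb c e F J₁ J₂).re : ℂ)) := by
  have hn' : 2 * t ≤ n := hn.le
  refine ⟨fun lam h c T₁ T₂ y => ?_, fun lam h H => GrossKunze.span_real_invariants h hn' H, ?_⟩
  · have := GrossKunze.isRealPair_of_mem_realSpan (c := c) h hn' 1 y
      (Submodule.subset_span ⟨T₁, rfl⟩) (Submodule.subset_span ⟨T₂, rfl⟩)
    rwa [map_one, Module.End.one_apply] at this
  · intro D _ N orb S _ Lam hLam c d e he F hF
    refine ⟨fun l => (F l).map Complex.re, fun l => ?_, ?_, ?_, fun J₁ _ J₂ _ => ?_⟩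
    · exact GrossKunze.posSemidef_of_map_ofReal (GrossKunze.posSemidef_map_re (hF.posSemidef l))
    · exact GrossKunze.isFeasible_map_re orb c e hn' hLam he hF
    · rw [GrossKunze.kernel_map_re orb c e hn' hLam he F]
      exact Complex.conj_eq_iff_re.1
        (GrossKunze.conj_kernel orb c e (fun l => (hF.posSemidef l).1) ∅ ∅)
    · exact GrossKunze.kernel_map_re orb c e hn' hLam he F J₁ J₂
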